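/- **Setting.** Let $M$ be a connected Riemann surface and let $F:M\to\mathbb R^3$ be a smooth conformal immersion. For an immersion of $M$ let $n$ be the unit normal determined by the orientation of $M$, let $\mathrm I$, $H$, $K$ be the induced metric, the mean curvature and the Gaussian curvature, and let $k_1\ge k_2$ be the principal curvatures. The Möbius metric is $(H^2-K)\,\mathrm I$. For a conformal immersion and a local complex coordinate $z$ write $\mathrm I=e^{\omega}\,dz\,d\bar z$ and $Q=\langle F_{zz},n\rangle$ (the coefficient of the Hopf differential $Q\,dz^2$). Assume that $F$ is umbilic-free, i.e. $H^2-K$ has no zero. A *deformation* of $F$ is a family of immersions $F_t:M\to\mathbb R^3$ $(t\in\mathbb R)$, smooth in $(t,p)$, with $F_0=F$. It preserves the ratio of principal curvatures if for all $t$ and $p$ the ratio $(k_1:k_2)$ of $F_t$ at $p$, as a point of the projective line and up to exchanging $k_1$ and $k_2$, is that of $F$ at $p$. $F$ is a *Bonnet surface* if it has a deformation $(G_t)$ such that every $G_t$ has the same induced metric and the same mean curvature as $F$, and some $G_t$ is not the composition of $F$ with an isometry of $\mathbb R^3$. $F$ is an *HIMC surface* if $H$ has no zero and $1/H$ is harmonic.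 **Theorem 2.4.** Let $(F_t)$ be a deformation of $F$ that preserves the Möbius metric and the ratio of principal curvatures. Then every $F_t$ is a conformal immersion of $M$, and there are functions $\lambda_t:M\to\mathbb C$ $(t\in\mathbb R)$ such that in every local complex coordinate the data $(\omega_t,H_t,Q_t)$ of $F_t$ are $$e^{\omega_t}=|\lambda_t|^2e^{\omega},\qquad H_t=\frac1{|\lambda_t|}H,\qquad Q_t=\lambda_tQ ,$$ and for every $t$ and every simply connected open set $U\subset M$ there is a holomorphic function $f$ on $U$ with $|\lambda_t|=|f|$ on $U$. Moreover: 1. If $|\lambda_t|=1$ for all $t$, and some $F_t$ is not the composition of $F$ with a similarity transformation of $\mathbb R^3$, then $F$ is a Bonnet surface. 2. If $F$ is not minimal ($H\not\equiv0$), and for some $t$ the function $\lambda_t$ is holomorphic on $M$ and $F_t$ is not the composition of $F$ with a similarity transformation of $\mathbb R^3$, then $F$ is an HIMC surface. -/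

import Mathlib

open scoped Manifold ContDiff

noncomputable section

/-- Euclidean three-space. -/
abbrev E3 : Type := EuclideanSpace ℝ (Fin 3)

/-! ### Surfaces in a local coordinate

`X : ℂ → E3` is a parametrized piece of a surface, with coordinate `z = x + i y`. Tangent vectors
of the parameter domain are complex numbers, so `1` is the direction of `x` and `Complex.I` the
direction of `y`. -/

/-- The first fundamental form (induced metric) `I(v, w) = ⟨dX(v), dX(w)⟩` at `z`. -/
def firstForm (X : ℂ → E3) (z v w : ℂ) : ℝ :=
  inner ℝ (fderiv ℝ X z v) (fderiv ℝ X z w)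

/-- The vector `X_x × X_y`. -/
def normalVector (X : ℂ → E3) (z : ℂ) : E3 :=
  WithLp.toLp 2 (crossProduct (WithLp.ofLp (fderiv ℝ X z 1)) (WithLp.ofLp (fderiv ℝ X z Complex.I)))

/-- The unit normal, chosen by the orientation of the coordinate `z`. -/
def unitNormal (X : ℂ → E3) (z : ℂ) : E3 :=
  ‖normalVector X z‖⁻¹ • normalVector X z

/-- The second fundamental form `II(v, w) = ⟨d²X(v, w), n⟩` at `z`. -/
def secondForm (X : ℂ → E3) (z v w : ℂ) : ℝ :=
  inner ℝ (fderiv ℝ (fderiv ℝ X) z v w) (unitNormal X z)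

/-- The determinant of the first fundamental form. -/
def firstFormDet (X : ℂ → E3) (z : ℂ) : ℝ :=
  firstForm X z 1 1 * firstForm X z Complex.I Complex.I - firstForm X z 1 Complex.I ^ 2

/-- The mean curvature: half the trace of the second fundamental form with respect to the first. -/
def meanCurvature (X : ℂ → E3) (z : ℂ) : ℝ :=
  (firstForm X z 1 1 * secondForm X z Complex.I Complex.I
      - 2 * (firstForm X z 1 Complex.I * secondForm X z 1 Complex.I)
      + firstForm X z Complex.I Complex.I * secondForm X z 1 1) / (2 * firstFormDet X z)

/-- The Gaussian curvature: the determinant of the second fundamental form with respect to the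
first. -/
def gaussCurvature (X : ℂ → E3) (z : ℂ) : ℝ :=
  (secondForm X z 1 1 * secondForm X z Complex.I Complex.I - secondForm X z 1 Complex.I ^ 2)
    / firstFormDet X z

/-- The larger principal curvature. -/
def principalCurvature₁ (X : ℂ → E3) (z : ℂ) : ℝ :=
  meanCurvature X z + √(meanCurvature X z ^ 2 - gaussCurvature X z)

/-- The smaller principal curvature. -/
def principalCurvature₂ (X : ℂ → E3) (z : ℂ) : ℝ :=
  meanCurvature X z - √(meanCurvature X z ^ 2 - gaussCurvature X z)

/-- `X` and `Y` have the same ratio of principal curvatures at `z`. A principal curvature may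
vanish, so the ratio is the point `(k₁ : k₂)` of the projective line; which of the two principal
curvatures comes first depends on the side of the normal, so a ratio and its inverse are
identified. (Where the mean curvatures do not vanish, this says that `K / H ^ 2` is the same.) -/
def SameCurvatureRatio (X Y : ℂ → E3) (z : ℂ) : Prop :=
  principalCurvature₁ X z * principalCurvature₂ Y z
      = principalCurvature₂ X z * principalCurvature₁ Y z ∨
    principalCurvature₁ X z * principalCurvature₁ Y z
      = principalCurvature₂ X z * principalCurvature₂ Y z

/-- The Möbius metric `(H ^ 2 - K) I`. -/
def moebiusMetric (X : ℂ → E3) (z v w : ℂ) : ℝ :=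
  (meanCurvature X z ^ 2 - gaussCurvature X z) * firstForm X z v w

/-- The factor `e ^ ω` of the metric `I = e ^ ω dz dz̄` of a conformally parametrized surface. -/
def conformalFactor (X : ℂ → E3) (z : ℂ) : ℝ :=
  firstForm X z 1 1

/-- The coefficient `Q = ⟨X_zz, n⟩` of the Hopf differential `Q dz ^ 2`, where
`X_zz = (X_xx - X_yy - 2 i X_xy) / 4` and the inner product is extended complex bilinearly. -/
def hopfCoeff (X : ℂ → E3) (z : ℂ) : ℂ :=
  ((secondForm X z 1 1 : ℂ) - (secondForm X z Complex.I Complex.I : ℂ)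
    - 2 * Complex.I * (secondForm X z 1 Complex.I : ℂ)) / 4

/-! ### Surfaces defined on a Riemann surface -/

/-- The local complex coordinates of a Riemann surface `M`. -/
abbrev complexCoords (M : Type*) [TopologicalSpace M] [ChartedSpace ℂ M] :
    Set (OpenPartialHomeomorph M ℂ) :=
  IsManifold.maximalAtlas 𝓘(ℂ) ω M

/-- `F` is a smooth conformal immersion of the Riemann surface `M`. -/
structure IsConformalImmersion {M : Type*} [TopologicalSpace M] [ChartedSpace ℂ M]
    (F : M → E3) : Prop where
  smooth : ∀ e ∈ complexCoords M, ContDiffOn ℝ ∞ (F ∘ e.symm) e.target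
  conformal : ∀ e ∈ complexCoords M, ∀ z ∈ e.target, ConformalAt (F ∘ e.symm) z

/-- `F` has no umbilic, that is, `H ^ 2 - K` has no zero. -/
def UmbilicFree {M : Type*} [TopologicalSpace M] [ChartedSpace ℂ M] (F : M → E3) : Prop :=
  ∀ e ∈ complexCoords M, ∀ z ∈ e.target,
    meanCurvature (F ∘ e.symm) z ^ 2 - gaussCurvature (F ∘ e.symm) z ≠ 0

/-- `F` is minimal: its mean curvature is identically zero. -/
def IsMinimalSurface {M : Type*} [TopologicalSpace M] [ChartedSpace ℂ M] (F : M → E3) : Prop :=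
  ∀ e ∈ complexCoords M, ∀ z ∈ e.target, meanCurvature (F ∘ e.symm) z = 0

/-- `Φ` is a deformation of `F`: a smooth one-parameter family of immersions that starts at `F`.
The members of the family are not assumed to be conformal. -/
structure IsDeformation {M : Type*} [TopologicalSpace M] [ChartedSpace ℂ M]
    (F : M → E3) (Φ : ℝ → M → E3) : Prop where
  start : Φ 0 = F
  smooth : ∀ e ∈ complexCoords M,
    ContDiffOn ℝ ∞ (fun q : ℝ × ℂ => Φ q.1 (e.symm q.2)) (Set.univ ×ˢ e.target)
  immersion : ∀ t, ∀ e ∈ complexCoords M, ∀ z ∈ e.target,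
    Function.Injective (fderiv ℝ (Φ t ∘ e.symm) z)

/-- `F` and `G` have the same Möbius metric. -/
def SameMoebiusMetric {M : Type*} [TopologicalSpace M] [ChartedSpace ℂ M]
    (F G : M → E3) : Prop :=
  ∀ e ∈ complexCoords M, ∀ z ∈ e.target, ∀ v w : ℂ,
    moebiusMetric (G ∘ e.symm) z v w = moebiusMetric (F ∘ e.symm) z v w

/-- `F` and `G` have the same ratio of principal curvatures at every point. -/
def SamePrincipalRatio {M : Type*} [TopologicalSpace M] [ChartedSpace ℂ M]
    (F G : M → E3) : Prop :=
  ∀ e ∈ complexCoords M, ∀ z ∈ e.target, SameCurvatureRatio (F ∘ e.symm) (G ∘ e.symm) z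

/-- `G` is the composition of `F` with a similarity of Euclidean space. -/
def SimilarSurfaces {M : Type*} (F G : M → E3) : Prop :=
  ∃ (r : ℝ) (A : E3 ≃ₗᵢ[ℝ] E3) (b : E3), 0 < r ∧ ∀ p, G p = r • A (F p) + b

/-- `G` is the composition of `F` with an isometry of Euclidean space. -/
def CongruentSurfaces {M : Type*} (F G : M → E3) : Prop :=
  ∃ (A : E3 ≃ₗᵢ[ℝ] E3) (b : E3), ∀ p, G p = A (F p) + b

/-- `F` is a Bonnet surface: it admits a non-trivial isometric deformation that preserves the mean
curvature. -/
def IsBonnetSurface {M : Type*} [TopologicalSpace M] [ChartedSpace ℂ M] (F : M → E3) : Prop :=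
  ∃ Φ : ℝ → M → E3, IsDeformation F Φ ∧
    (∀ t, ∀ e ∈ complexCoords M, ∀ z ∈ e.target,
      (∀ v w : ℂ, firstForm (Φ t ∘ e.symm) z v w = firstForm (F ∘ e.symm) z v w) ∧
      meanCurvature (Φ t ∘ e.symm) z = meanCurvature (F ∘ e.symm) z) ∧
    ∃ t, ¬ CongruentSurfaces F (Φ t)

/-- `F` is a surface with harmonic inverse mean curvature. -/
def IsHIMCSurface {M : Type*} [TopologicalSpace M] [ChartedSpace ℂ M] (F : M → E3) : Prop :=
  ∀ e ∈ complexCoords M,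
    (∀ z ∈ e.target, meanCurvature (F ∘ e.symm) z ≠ 0) ∧
    InnerProductSpace.HarmonicOnNhd (fun z => 1 / meanCurvature (F ∘ e.symm) z) e.target

end

/-! Write E = e^ω. In a conformal coordinate H² − K = 4|Q|²/E² (`ConformalOn.sq_sub_gauss`), so
umbilics are the zeros of Q and the Möbius metric is (4|Q|²/E)|dz|². A surface sharing the Möbius
metric of F is therefore conformal. The quotient λ_t = Q_t/Q does not depend on the coordinate, and
equality of the Möbius metrics becomes E_t = |λ_t|²E. The principal curvatures are H ± 2|Q|/E, so
equality of their ratios means |λ_t|H_t = ±H; continuity in t, starting from F_0 = F, selects the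
plus sign. `scaledData_of_deformation` collects these relations.

They leave KE unchanged, so the Gauss equation Δ log E = −2KE makes log|λ_t| harmonic. On a simply
connected open set it is the real part of a holomorphic function g, and f = e^g has modulus |λ_t|.
The local harmonic conjugates are glued by lifting through a covering
(`exists_global_of_locally_const_sub`).

If |λ_t| = 1 for all t, the given deformation is itself a Bonnet deformation.

If λ_t is holomorphic, write λ_t = w⁻² locally. Comparing the Codazzi equations Q_z̄ = (E/2)H_z of
the two surfaces gives ∂_z(H(w − w̄)) = 0, so H Im w is a real constant k near each point
(`ConformalOn.fderiv_meanCurvature_mul_im`). Its sign depends on the branch, but 2k² = H²(|1/λ_t| −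
Re(1/λ_t)) is globally defined, hence constant. If it vanishes, λ_t is positive wherever H ≠ 0, so
it is constant by the identity theorem, and uniqueness of a surface with given E, H, Q
(`congruent_of_data`) makes F_t similar to F. Otherwise H has no zero and 1/H = (Im w)/k is
harmonic. -/

/-! ### Directional derivatives in the coordinate plane -/

section Directional

variable {V W : Type*} [NormedAddCommGroup V] [NormedSpace ℝ V] [NormedAddCommGroup W]
  [InnerProductSpace ℝ W] {f g : ℂ → V} {Ω : Set ℂ} {z : ℂ}

/-- The derivative of `f` in the constant direction `v`. -/
noncomputable def pd (v : ℂ) (f : ℂ → V) (z : ℂ) : V := fderiv ℝ f z v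

theorem smoothAt_of_mem (hΩ : IsOpen Ω) (hf : ContDiffOn ℝ ∞ f Ω) (hz : z ∈ Ω) :
    ContDiffAt ℝ ∞ f z := hf.contDiffAt (hΩ.mem_nhds hz)

theorem differentiableAt_of_mem (hΩ : IsOpen Ω) (hf : ContDiffOn ℝ ∞ f Ω) (hz : z ∈ Ω) :
    DifferentiableAt ℝ f z := (smoothAt_of_mem hΩ hf hz).differentiableAt (by simp)

theorem ContDiffOn.fderiv_infty (hΩ : IsOpen Ω) (hf : ContDiffOn ℝ ∞ f Ω) :
    ContDiffOn ℝ ∞ (fderiv ℝ f) Ω := hf.fderiv_of_isOpen hΩ (by simp)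

theorem ContDiffOn.pd (hΩ : IsOpen Ω) (hf : ContDiffOn ℝ ∞ f Ω) (v : ℂ) :
    ContDiffOn ℝ ∞ (pd v f) Ω := (hf.fderiv_infty hΩ).clm_apply contDiffOn_const

theorem pd_pd (hΩ : IsOpen Ω) (hf : ContDiffOn ℝ ∞ f Ω) (hz : z ∈ Ω) (v w : ℂ) :
    pd v (pd w f) z = fderiv ℝ (fderiv ℝ f) z v w := by
  have h := differentiableAt_of_mem hΩ (hf.fderiv_infty hΩ) hz
  have : pd w f = fun y => fderiv ℝ f y w := rfl
  rw [_root_.pd, this, fderiv_clm_apply h (differentiableAt_const _)]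
  simp

theorem pd_comm (hΩ : IsOpen Ω) (hf : ContDiffOn ℝ ∞ f Ω) (hz : z ∈ Ω) (v w : ℂ) :
    pd v (pd w f) z = pd w (pd v f) z := by
  rw [pd_pd hΩ hf hz, pd_pd hΩ hf hz]
  exact (smoothAt_of_mem hΩ hf hz).isSymmSndFDerivAt (by
    rw [minSmoothness_of_isRCLikeNormedField]; exact ENat.LEInfty.out) v w

theorem pd_congr (hΩ : IsOpen Ω) (h : Set.EqOn f g Ω) (v : ℂ) : Set.EqOn (pd v f) (pd v g) Ω :=
  fun z hz => by rw [pd, pd, (h.eventuallyEq_of_mem (hΩ.mem_nhds hz)).fderiv_eq]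

theorem pd_const (v : ℂ) (c : V) : pd v (fun _ => c) z = 0 := by simp [pd]

theorem pd_add (hf : DifferentiableAt ℝ f z) (hg : DifferentiableAt ℝ g z) (v : ℂ) :
    pd v (fun y => f y + g y) z = pd v f z + pd v g z := by
  simp [pd, fderiv_fun_add hf hg]

theorem pd_sub (hf : DifferentiableAt ℝ f z) (hg : DifferentiableAt ℝ g z) (v : ℂ) :
    pd v (fun y => f y - g y) z = pd v f z - pd v g z := by
  simp [pd, fderiv_fun_sub hf hg]

theorem pd_inner {f g : ℂ → W} (hf : DifferentiableAt ℝ f z) (hg : DifferentiableAt ℝ g z)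
    (v : ℂ) : pd v (fun y => inner ℝ (f y) (g y)) z
      = inner ℝ (pd v f z) (g z) + inner ℝ (f z) (pd v g z) := by
  rw [pd, fderiv_inner_apply ℝ hf hg, add_comm]; rfl

theorem pd_mul {A : Type*} [NormedRing A] [NormedAlgebra ℝ A] {f g : ℂ → A}
    (hf : DifferentiableAt ℝ f z) (hg : DifferentiableAt ℝ g z) (v : ℂ) :
    pd v (fun y => f y * g y) z = pd v f z * g z + f z * pd v g z := by
  rw [pd, fderiv_fun_mul' hf hg, add_comm]
  simp [pd]

theorem pd_const_mul {A : Type*} [NormedRing A] [NormedAlgebra ℝ A] {f : ℂ → A}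
    (hf : DifferentiableAt ℝ f z) (c : A) (v : ℂ) :
    pd v (fun y => c * f y) z = c * pd v f z := by
  rw [pd, fderiv_const_mul hf]; rfl

theorem pd_ofReal {f : ℂ → ℝ} (hf : DifferentiableAt ℝ f z) (v : ℂ) :
    pd v (fun y => (f y : ℂ)) z = ((pd v f z : ℝ) : ℂ) := by
  have := (Complex.ofRealCLM.hasFDerivAt (x := f z)).comp z hf.hasFDerivAt
  rw [pd, show (fun y => (f y : ℂ)) = Complex.ofRealCLM ∘ f from rfl, this.fderiv]; rfl

theorem pd_conj {f : ℂ → ℂ} (hf : DifferentiableAt ℝ f z) (v : ℂ) :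
    pd v (fun y => (starRingEnd ℂ) (f y)) z = (starRingEnd ℂ) (pd v f z) := by
  have := (Complex.conjCLE.toContinuousLinearMap.hasFDerivAt (x := f z)).comp z hf.hasFDerivAt
  rw [pd, show (fun y => (starRingEnd ℂ) (f y)) = Complex.conjCLE.toContinuousLinearMap ∘ f from rfl,
    this.fderiv]; rfl

theorem pd_holomorphic {f : ℂ → ℂ} (hf : DifferentiableAt ℂ f z) (v : ℂ) :
    pd v f z = v * deriv f z := by
  rw [pd, hf.fderiv_restrictScalars ℝ]
  simp

theorem fderiv_eq_zero_of_pd (h1 : pd 1 f z = 0) (h2 : pd Complex.I f z = 0) :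
    fderiv ℝ f z = 0 := by
  ext v
  have : v = v.re • (1 : ℂ) + v.im • Complex.I := by simp
  rw [this, map_add, map_smul, map_smul, show fderiv ℝ f z 1 = 0 from h1,
    show fderiv ℝ f z Complex.I = 0 from h2]
  simp

end Directional

/-! ### The vector product in Euclidean space -/

/-- The vector product of `E3`. -/
def cross3 (a b : E3) : E3 := WithLp.toLp 2 (crossProduct (WithLp.ofLp a) (WithLp.ofLp b))

theorem inner_cross3_left (a b : E3) : inner ℝ (cross3 a b) a = 0 := by
  simp [cross3, EuclideanSpace.inner_eq_star_dotProduct, dot_self_cross]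

theorem inner_cross3_right (a b : E3) : inner ℝ (cross3 a b) b = 0 := by
  simp [cross3, EuclideanSpace.inner_eq_star_dotProduct, dot_cross_self]

theorem inner_cross3_self (a b : E3) : inner ℝ (cross3 a b) (cross3 a b)
    = inner ℝ a a * inner ℝ b b - inner ℝ a b ^ 2 := by
  simp only [cross3, EuclideanSpace.inner_eq_star_dotProduct, star_trivial, cross_dot_cross]
  rw [dotProduct_comm b.ofLp a.ofLp]; ring

theorem ContDiffOn.cross3 {a b : ℂ → E3} {Ω : Set ℂ} (ha : ContDiffOn ℝ ∞ a Ω)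
    (hb : ContDiffOn ℝ ∞ b Ω) : ContDiffOn ℝ ∞ (fun z => cross3 (a z) (b z)) Ω := by
  rw [contDiffOn_euclidean] at *
  intro i
  have := ha 0; have := ha 1; have := ha 2; have := hb 0; have := hb 1; have := hb 2
  fin_cases i <;> simp [_root_.cross3, crossProduct] <;> fun_prop

/-- Parseval's identity in the orthogonal frame `a, b, n`. -/
theorem inner_eq_of_frame {a b n : E3} {r : ℝ} (hr : 0 < r) (haa : inner ℝ a a = r)
    (hbb : inner ℝ b b = r) (hnn : inner ℝ n n = (1 : ℝ)) (hab : inner ℝ a b = (0 : ℝ))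
    (hna : inner ℝ n a = (0 : ℝ)) (hnb : inner ℝ n b = (0 : ℝ)) (u v : E3) :
    inner ℝ u v = inner ℝ u a * inner ℝ v a / r + inner ℝ u b * inner ℝ v b / r
      + inner ℝ u n * inner ℝ v n := by
  have hs : √r * √r = r := Real.mul_self_sqrt hr.le
  have hs0 : √r ≠ 0 := (Real.sqrt_pos.2 hr).ne'
  let e : Fin 3 → E3 := ![(√r)⁻¹ • a, (√r)⁻¹ • b, n]
  have hon : Orthonormal ℝ e := by
    rw [orthonormal_iff_ite]
    have hba : inner ℝ b a = (0 : ℝ) := by rw [real_inner_comm]; exact hab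
    have han : inner ℝ a n = (0 : ℝ) := by rw [real_inner_comm]; exact hna
    have hbn : inner ℝ b n = (0 : ℝ) := by rw [real_inner_comm]; exact hnb
    have key : (√r)⁻¹ * ((√r)⁻¹ * r) = 1 := by
      rw [← hs]; simp only [hs]; field_simp
      rw [sq, hs]
    intro i j
    have e0 : e 0 = (√r)⁻¹ • a := rfl
    have e1 : e 1 = (√r)⁻¹ • b := rfl
    have e2 : e 2 = n := rfl
    fin_cases i <;> fin_cases j <;>
      simp only [Fin.zero_eta, Fin.mk_one, Fin.reduceFinMk, e0, e1, e2, real_inner_smul_left,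
        real_inner_smul_right, haa, hbb, hnn, hab, hna, hnb, hba, han, hbn, key, mul_zero,
        Fin.isValue, if_true] <;> simp
  let B : OrthonormalBasis (Fin 3) ℝ E3 :=
    (basisOfOrthonormalOfCardEqFinrank hon (by simp)).toOrthonormalBasis
      (by simpa using hon)
  have hB : ∀ i, B i = e i := by intro i; simp [B]
  have := B.sum_inner_mul_inner u v
  rw [← this, Fin.sum_univ_three, hB, hB, hB]
  simp only [e, Matrix.cons_val_zero, Matrix.cons_val_one, Matrix.cons_val, inner_smul_left,
    inner_smul_right]
  rw [real_inner_comm a v, real_inner_comm b v, real_inner_comm n v]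
  have h2 : (√r)⁻¹ * (√r)⁻¹ = r⁻¹ := by rw [← mul_inv, hs]
  simp only [map_inv₀, conj_trivial, div_eq_mul_inv, ← h2]
  ring

/-- A vector orthogonal to the orthogonal frame `a, b, n` vanishes. -/
theorem ext_of_frame {a b n : E3} {r : ℝ} (hr : 0 < r) (haa : inner ℝ a a = r)
    (hbb : inner ℝ b b = r) (hnn : inner ℝ n n = (1 : ℝ)) (hab : inner ℝ a b = (0 : ℝ))
    (hna : inner ℝ n a = (0 : ℝ)) (hnb : inner ℝ n b = (0 : ℝ)) {u v : E3}
    (ha : inner ℝ u a = (inner ℝ v a : ℝ)) (hb : inner ℝ u b = (inner ℝ v b : ℝ))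
    (hn : inner ℝ u n = (inner ℝ v n : ℝ)) : u = v := by
  rw [← sub_eq_zero, ← inner_self_eq_zero (𝕜 := ℝ),
    inner_eq_of_frame hr haa hbb hnn hab hna hnb]
  simp [inner_sub_left, ha, hb, hn]

/-! ### Conformally parametrized surfaces in a coordinate domain -/

open Complex (I)

/-- `X` is a smooth conformally parametrized surface over the open set `Ω`. -/
structure ConformalOn (X : ℂ → E3) (Ω : Set ℂ) : Prop where
  isOpen : IsOpen Ω
  smooth : ContDiffOn ℝ ∞ X Ω
  pos : ∀ z ∈ Ω, 0 < conformalFactor X z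
  eq : ∀ z ∈ Ω, firstForm X z I I = conformalFactor X z
  orth : ∀ z ∈ Ω, firstForm X z 1 I = 0

namespace ConformalOn

variable {X : ℂ → E3} {Ω : Set ℂ} {z : ℂ}

theorem smooth_pd (h : ConformalOn X Ω) (v : ℂ) : ContDiffOn ℝ ∞ (pd v X) Ω :=
  h.smooth.pd h.isOpen v

theorem smooth_pd_pd (h : ConformalOn X Ω) (v w : ℂ) : ContDiffOn ℝ ∞ (pd v (pd w X)) Ω :=
  (h.smooth_pd w).pd h.isOpen v

theorem diff (h : ConformalOn X Ω) (hz : z ∈ Ω) : DifferentiableAt ℝ X z :=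
  differentiableAt_of_mem h.isOpen h.smooth hz

theorem diff_pd (h : ConformalOn X Ω) (hz : z ∈ Ω) (v : ℂ) : DifferentiableAt ℝ (pd v X) z :=
  differentiableAt_of_mem h.isOpen (h.smooth_pd v) hz

theorem diff_pd_pd (h : ConformalOn X Ω) (hz : z ∈ Ω) (v w : ℂ) :
    DifferentiableAt ℝ (pd v (pd w X)) z :=
  differentiableAt_of_mem h.isOpen (h.smooth_pd_pd v w) hz

theorem smooth_conformalFactor (h : ConformalOn X Ω) :
    ContDiffOn ℝ ∞ (conformalFactor X) Ω :=
  (h.smooth_pd 1).inner ℝ (h.smooth_pd 1)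

theorem diff_conformalFactor (h : ConformalOn X Ω) (hz : z ∈ Ω) :
    DifferentiableAt ℝ (conformalFactor X) z :=
  differentiableAt_of_mem h.isOpen h.smooth_conformalFactor hz

theorem inner_xx (X : ℂ → E3) (z : ℂ) :
    inner ℝ (pd 1 X z) (pd 1 X z) = conformalFactor X z := rfl

theorem inner_yy (h : ConformalOn X Ω) (hz : z ∈ Ω) :
    inner ℝ (pd I X z) (pd I X z) = conformalFactor X z := h.eq z hz

theorem inner_xy (h : ConformalOn X Ω) (hz : z ∈ Ω) :
    inner ℝ (pd 1 X z) (pd I X z) = (0 : ℝ) := h.orth z hz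

theorem normalVector_eq (X : ℂ → E3) (z : ℂ) :
    normalVector X z = cross3 (pd 1 X z) (pd I X z) := rfl

theorem norm_normalVector (h : ConformalOn X Ω) (hz : z ∈ Ω) :
    ‖normalVector X z‖ = conformalFactor X z := by
  rw [← abs_of_pos (h.pos z hz), ← abs_norm, ← sq_eq_sq_iff_abs_eq_abs,
    ← real_inner_self_eq_norm_sq, normalVector_eq, inner_cross3_self, h.inner_yy hz, h.inner_xy hz,
    inner_xx]
  ring

theorem unitNormal_eq (h : ConformalOn X Ω) (hz : z ∈ Ω) :
    unitNormal X z = (conformalFactor X z)⁻¹ • cross3 (pd 1 X z) (pd I X z) := by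
  rw [unitNormal, h.norm_normalVector hz, normalVector_eq]

theorem smooth_unitNormal (h : ConformalOn X Ω) : ContDiffOn ℝ ∞ (unitNormal X) Ω := by
  refine ContDiffOn.congr ?_ (fun z hz => h.unitNormal_eq hz)
  exact (h.smooth_conformalFactor.inv fun z hz => (h.pos z hz).ne').smul
    ((h.smooth_pd 1).cross3 (h.smooth_pd I))

theorem diff_unitNormal (h : ConformalOn X Ω) (hz : z ∈ Ω) :
    DifferentiableAt ℝ (unitNormal X) z :=
  differentiableAt_of_mem h.isOpen h.smooth_unitNormal hz

theorem inner_nx (h : ConformalOn X Ω) (hz : z ∈ Ω) :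
    inner ℝ (unitNormal X z) (pd 1 X z) = (0 : ℝ) := by
  rw [h.unitNormal_eq hz, real_inner_smul_left, inner_cross3_left, mul_zero]

theorem inner_ny (h : ConformalOn X Ω) (hz : z ∈ Ω) :
    inner ℝ (unitNormal X z) (pd I X z) = (0 : ℝ) := by
  rw [h.unitNormal_eq hz, real_inner_smul_left, inner_cross3_right, mul_zero]

theorem inner_nn (h : ConformalOn X Ω) (hz : z ∈ Ω) :
    inner ℝ (unitNormal X z) (unitNormal X z) = (1 : ℝ) := by
  have hp := (h.pos z hz).ne'
  rw [h.unitNormal_eq hz, real_inner_smul_left, real_inner_smul_right, inner_cross3_self,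
    h.inner_yy hz, h.inner_xy hz, inner_xx]
  field_simp
  ring

theorem inner_eq (h : ConformalOn X Ω) (hz : z ∈ Ω) (u v : E3) :
    inner ℝ u v = inner ℝ u (pd 1 X z) * inner ℝ v (pd 1 X z) / conformalFactor X z
      + inner ℝ u (pd I X z) * inner ℝ v (pd I X z) / conformalFactor X z
      + inner ℝ u (unitNormal X z) * inner ℝ v (unitNormal X z) :=
  inner_eq_of_frame (h.pos z hz) (inner_xx X z) (h.inner_yy hz) (h.inner_nn hz) (h.inner_xy hz)
    (h.inner_nx hz) (h.inner_ny hz) u v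

theorem ext (h : ConformalOn X Ω) (hz : z ∈ Ω) {u v : E3}
    (h1 : inner ℝ u (pd 1 X z) = (inner ℝ v (pd 1 X z) : ℝ))
    (h2 : inner ℝ u (pd I X z) = (inner ℝ v (pd I X z) : ℝ))
    (h3 : inner ℝ u (unitNormal X z) = (inner ℝ v (unitNormal X z) : ℝ)) : u = v :=
  ext_of_frame (h.pos z hz) (inner_xx X z) (h.inner_yy hz) (h.inner_nn hz) (h.inner_xy hz)
    (h.inner_nx hz) (h.inner_ny hz) h1 h2 h3

theorem secondForm_eq (h : ConformalOn X Ω) (hz : z ∈ Ω) (v w : ℂ) :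
    secondForm X z v w = inner ℝ (pd v (pd w X) z) (unitNormal X z) := by
  rw [secondForm, pd_pd h.isOpen h.smooth hz]

theorem smooth_secondForm (h : ConformalOn X Ω) (v w : ℂ) :
    ContDiffOn ℝ ∞ (fun z => secondForm X z v w) Ω :=
  ((h.smooth_pd_pd v w).inner ℝ h.smooth_unitNormal).congr fun _ hz => h.secondForm_eq hz v w

theorem pd_yx (h : ConformalOn X Ω) (hz : z ∈ Ω) : pd I (pd 1 X) z = pd 1 (pd I X) z :=
  pd_comm h.isOpen h.smooth hz I 1

/-! Components of the second derivatives in the moving frame. -/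

theorem pd_conformalFactor (h : ConformalOn X Ω) (hz : z ∈ Ω) (v : ℂ) :
    pd v (conformalFactor X) z = 2 * inner ℝ (pd v (pd 1 X) z) (pd 1 X z) := by
  have := pd_inner (h.diff_pd hz 1) (h.diff_pd hz 1) v
  rw [real_inner_comm (pd v (pd 1 X) z)] at this
  rw [two_mul]; exact this

theorem pd_conformalFactor' (h : ConformalOn X Ω) (hz : z ∈ Ω) (v : ℂ) :
    pd v (conformalFactor X) z = 2 * inner ℝ (pd v (pd I X) z) (pd I X z) := by
  have := pd_inner (h.diff_pd hz I) (h.diff_pd hz I) v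
  rw [real_inner_comm (pd v (pd I X) z), ← two_mul] at this
  rw [← this]
  exact pd_congr h.isOpen (fun y hy => (h.inner_yy hy).symm) v hz

theorem inner_pd_xy (h : ConformalOn X Ω) (hz : z ∈ Ω) (v : ℂ) :
    inner ℝ (pd v (pd 1 X) z) (pd I X z) + inner ℝ (pd v (pd I X) z) (pd 1 X z) = (0 : ℝ) := by
  have := pd_inner (h.diff_pd hz 1) (h.diff_pd hz I) v
  rw [real_inner_comm (pd v (pd I X) z)] at this
  rw [← this, pd_congr h.isOpen (fun y hy => h.inner_xy hy) v hz, pd_const]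

theorem xx_x (h : ConformalOn X Ω) (hz : z ∈ Ω) :
    inner ℝ (pd 1 (pd 1 X) z) (pd 1 X z) = pd 1 (conformalFactor X) z / 2 := by
  rw [h.pd_conformalFactor hz]; ring

theorem xy_x (h : ConformalOn X Ω) (hz : z ∈ Ω) :
    inner ℝ (pd 1 (pd I X) z) (pd 1 X z) = pd I (conformalFactor X) z / 2 := by
  rw [h.pd_conformalFactor hz, h.pd_yx hz]; ring

theorem xy_y (h : ConformalOn X Ω) (hz : z ∈ Ω) :
    inner ℝ (pd 1 (pd I X) z) (pd I X z) = pd 1 (conformalFactor X) z / 2 := by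
  rw [h.pd_conformalFactor' hz]; ring

theorem yy_y (h : ConformalOn X Ω) (hz : z ∈ Ω) :
    inner ℝ (pd I (pd I X) z) (pd I X z) = pd I (conformalFactor X) z / 2 := by
  rw [h.pd_conformalFactor' hz]; ring

theorem xx_y (h : ConformalOn X Ω) (hz : z ∈ Ω) :
    inner ℝ (pd 1 (pd 1 X) z) (pd I X z) = -pd I (conformalFactor X) z / 2 := by
  have h1 := h.inner_pd_xy hz 1
  have h2 := h.xy_x hz
  linarith

theorem yy_x (h : ConformalOn X Ω) (hz : z ∈ Ω) :
    inner ℝ (pd I (pd I X) z) (pd 1 X z) = -pd 1 (conformalFactor X) z / 2 := by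
  have h1 := h.inner_pd_xy hz I
  have h2 := h.xy_y hz
  rw [h.pd_yx hz] at h1
  linarith

/-! Components of the derivative of the normal in the moving frame. -/

theorem pd_n_n (h : ConformalOn X Ω) (hz : z ∈ Ω) (v : ℂ) :
    inner ℝ (pd v (unitNormal X) z) (unitNormal X z) = (0 : ℝ) := by
  have := pd_inner (h.diff_unitNormal hz) (h.diff_unitNormal hz) v
  rw [real_inner_comm (pd v (unitNormal X) z), pd_congr h.isOpen (fun y hy => h.inner_nn hy) v hz,
    pd_const] at this
  linarith

theorem pd_n_x (h : ConformalOn X Ω) (hz : z ∈ Ω) (v : ℂ) :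
    inner ℝ (pd v (unitNormal X) z) (pd 1 X z) = -secondForm X z v 1 := by
  have := pd_inner (h.diff_unitNormal hz) (h.diff_pd hz 1) v
  rw [real_inner_comm (pd v (pd 1 X) z), pd_congr h.isOpen (fun y hy => h.inner_nx hy) v hz,
    pd_const] at this
  rw [h.secondForm_eq hz]
  linarith

theorem pd_n_y (h : ConformalOn X Ω) (hz : z ∈ Ω) (v : ℂ) :
    inner ℝ (pd v (unitNormal X) z) (pd I X z) = -secondForm X z v I := by
  have := pd_inner (h.diff_unitNormal hz) (h.diff_pd hz I) v
  rw [real_inner_comm (pd v (pd I X) z), pd_congr h.isOpen (fun y hy => h.inner_ny hy) v hz,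
    pd_const] at this
  rw [h.secondForm_eq hz]
  linarith

theorem secondForm_yx (h : ConformalOn X Ω) (hz : z ∈ Ω) :
    secondForm X z I 1 = secondForm X z 1 I := by
  rw [h.secondForm_eq hz, h.secondForm_eq hz, h.pd_yx hz]

/-! ### Curvatures, Gauss and Codazzi equations in a conformal coordinate. -/

theorem firstFormDet_eq (h : ConformalOn X Ω) (hz : z ∈ Ω) :
    firstFormDet X z = conformalFactor X z ^ 2 := by
  rw [firstFormDet, h.eq z hz, h.orth z hz, conformalFactor]; ring

theorem meanCurvature_eq (h : ConformalOn X Ω) (hz : z ∈ Ω) :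
    meanCurvature X z = (secondForm X z 1 1 + secondForm X z I I) / (2 * conformalFactor X z) := by
  have hp := (h.pos z hz).ne'
  rw [meanCurvature, h.firstFormDet_eq hz, h.eq z hz, h.orth z hz, ← conformalFactor]
  field_simp
  ring

theorem gaussCurvature_eq (h : ConformalOn X Ω) (hz : z ∈ Ω) :
    gaussCurvature X z = (secondForm X z 1 1 * secondForm X z I I - secondForm X z 1 I ^ 2)
      / conformalFactor X z ^ 2 := by
  rw [gaussCurvature, h.firstFormDet_eq hz]

theorem normSq_hopfCoeff (X : ℂ → E3) (z : ℂ) : ‖hopfCoeff X z‖ ^ 2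
    = ((secondForm X z 1 1 - secondForm X z I I) ^ 2 + 4 * secondForm X z 1 I ^ 2) / 16 := by
  have : hopfCoeff X z = (((secondForm X z 1 1 - secondForm X z I I) / 4 : ℝ) : ℂ)
      + ((-secondForm X z 1 I / 2 : ℝ) : ℂ) * I := by
    rw [hopfCoeff]; push_cast; ring
  rw [this, ← Complex.normSq_eq_norm_sq, Complex.normSq_add_mul_I]
  ring

/-- With second form coefficients L, M, N, both sides are ((L − N)² + 4M²)/(4E²). This links
umbilics, the Möbius metric and the principal curvatures to the Hopf differential. -/
theorem sq_sub_gauss (h : ConformalOn X Ω) (hz : z ∈ Ω) :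
    meanCurvature X z ^ 2 - gaussCurvature X z
      = 4 * ‖hopfCoeff X z‖ ^ 2 / conformalFactor X z ^ 2 := by
  have hp := (h.pos z hz).ne'
  rw [h.meanCurvature_eq hz, h.gaussCurvature_eq hz, normSq_hopfCoeff]
  field_simp
  ring

theorem smooth_meanCurvature (h : ConformalOn X Ω) : ContDiffOn ℝ ∞ (meanCurvature X) Ω := by
  refine ContDiffOn.congr ?_ (fun z hz => h.meanCurvature_eq hz)
  refine ((h.smooth_secondForm 1 1).add (h.smooth_secondForm I I)).div
    (contDiffOn_const.mul h.smooth_conformalFactor) fun z hz => ?_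
  have := (h.pos z hz).ne'
  positivity

/-- The Gauss equation. -/
theorem gauss (h : ConformalOn X Ω) (hz : z ∈ Ω) :
    conformalFactor X z * (pd 1 (pd 1 (conformalFactor X)) z + pd I (pd I (conformalFactor X)) z)
      - (pd 1 (conformalFactor X) z ^ 2 + pd I (conformalFactor X) z ^ 2)
      = -2 * gaussCurvature X z * conformalFactor X z ^ 3 := by
  have hp := (h.pos z hz).ne'
  have hE := h.smooth_conformalFactor
  -- `e1` and `e2` differentiate ⟨X_xy, X_x⟩ = E_y/2 along y and ⟨X_yy, X_x⟩ = −E_x/2 along x. The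
  -- third derivatives agree by `e3`, so the difference is (ΔE)/2 = |X_xy|² − ⟨X_xx, X_yy⟩, which is
  -- then expanded in the moving frame.
  have e1 : pd I (pd I (conformalFactor X)) z / 2
      = inner ℝ (pd I (pd 1 (pd I X)) z) (pd 1 X z)
        + inner ℝ (pd 1 (pd I X) z) (pd 1 (pd I X) z) := by
    have := pd_inner (h.diff_pd_pd hz 1 I) (h.diff_pd hz 1) I
    rw [h.pd_yx hz] at this
    rw [← this, pd_congr h.isOpen (fun y hy => h.xy_x hy) I hz]
    simp only [div_eq_inv_mul]
    rw [pd_const_mul (differentiableAt_of_mem h.isOpen (hE.pd h.isOpen I) hz)]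
  have e2 : -(pd 1 (pd 1 (conformalFactor X)) z / 2)
      = inner ℝ (pd 1 (pd I (pd I X)) z) (pd 1 X z)
        + inner ℝ (pd I (pd I X) z) (pd 1 (pd 1 X) z) := by
    have := pd_inner (h.diff_pd_pd hz I I) (h.diff_pd hz 1) 1
    rw [← this, pd_congr h.isOpen (fun y hy => h.yy_x hy) 1 hz]
    have e : (fun y => -pd 1 (conformalFactor X) y / 2)
        = fun y => (-1 / 2) * pd 1 (conformalFactor X) y := by ext; ring
    rw [e, pd_const_mul (differentiableAt_of_mem h.isOpen (hE.pd h.isOpen 1) hz)]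
    ring
  have e3 : pd I (pd 1 (pd I X)) z = pd 1 (pd I (pd I X)) z :=
    pd_comm h.isOpen (h.smooth_pd I) hz I 1
  rw [h.inner_eq hz (pd 1 (pd I X) z), h.xy_x hz, h.xy_y hz, ← h.secondForm_eq hz, e3] at e1
  rw [h.inner_eq hz (pd I (pd I X) z), h.xx_x hz, h.xx_y hz, h.yy_x hz, h.yy_y hz,
    ← h.secondForm_eq hz, ← h.secondForm_eq hz] at e2
  have e4 : pd 1 (pd 1 (conformalFactor X)) z + pd I (pd I (conformalFactor X)) z
      = 2 * (pd I (pd I (conformalFactor X)) z / 2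
        - -(pd 1 (pd 1 (conformalFactor X)) z / 2)) := by ring
  rw [e4, e1, e2, h.gaussCurvature_eq hz]
  field_simp
  ring

/-- The Codazzi equation for the derivatives along `y`. -/
theorem codazzi_aux₁ (h : ConformalOn X Ω) (hz : z ∈ Ω) :
    pd I (fun y => secondForm X y 1 1) z - pd 1 (fun y => secondForm X y 1 I) z
      = meanCurvature X z * pd I (conformalFactor X) z := by
  have hp := (h.pos z hz).ne'
  -- Third derivatives of X cancel in the difference. What remains is ⟨X_xx, n_y⟩ − ⟨X_xy, n_x⟩,
  -- computed in the moving frame.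
  have e1 := pd_inner (h.diff_pd_pd hz 1 1) (h.diff_unitNormal hz) I
  have e2 := pd_inner (h.diff_pd_pd hz 1 I) (h.diff_unitNormal hz) 1
  rw [pd_congr h.isOpen (fun y hy => h.secondForm_eq hy 1 1) I hz,
    pd_congr h.isOpen (fun y hy => h.secondForm_eq hy 1 I) 1 hz, e1, e2,
    pd_comm h.isOpen (h.smooth_pd 1) hz I 1,
    pd_congr h.isOpen (fun y hy => h.pd_yx hy) 1 hz,
    h.inner_eq hz (pd 1 (pd 1 X) z), h.inner_eq hz (pd 1 (pd I X) z), h.xx_x hz, h.xx_y hz,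
    h.xy_x hz, h.xy_y hz, h.pd_n_n hz, h.pd_n_n hz, h.pd_n_x hz, h.pd_n_x hz, h.pd_n_y hz,
    h.pd_n_y hz, h.secondForm_yx hz, h.meanCurvature_eq hz]
  field_simp
  ring

/-- The Codazzi equation for the derivatives along `x`. -/
theorem codazzi_aux₂ (h : ConformalOn X Ω) (hz : z ∈ Ω) :
    pd 1 (fun y => secondForm X y I I) z - pd I (fun y => secondForm X y 1 I) z
      = meanCurvature X z * pd 1 (conformalFactor X) z := by
  have hp := (h.pos z hz).ne'
  have e1 := pd_inner (h.diff_pd_pd hz I I) (h.diff_unitNormal hz) 1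
  have e2 := pd_inner (h.diff_pd_pd hz 1 I) (h.diff_unitNormal hz) I
  rw [pd_congr h.isOpen (fun y hy => h.secondForm_eq hy I I) 1 hz,
    pd_congr h.isOpen (fun y hy => h.secondForm_eq hy 1 I) I hz, e1, e2,
    pd_comm h.isOpen (h.smooth_pd I) hz I 1,
    h.inner_eq hz (pd I (pd I X) z), h.inner_eq hz (pd 1 (pd I X) z), h.yy_x hz, h.yy_y hz,
    h.xy_x hz, h.xy_y hz, h.pd_n_n hz, h.pd_n_n hz, h.pd_n_x hz, h.pd_n_x hz, h.pd_n_y hz,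
    h.pd_n_y hz, h.secondForm_yx hz, h.meanCurvature_eq hz]
  field_simp
  ring

theorem smooth_hopfCoeff (h : ConformalOn X Ω) : ContDiffOn ℝ ∞ (hopfCoeff X) Ω := by
  have hc : ∀ v w, ContDiffOn ℝ ∞ (fun z => (secondForm X z v w : ℂ)) Ω := fun v w =>
    Complex.ofRealCLM.contDiff.comp_contDiffOn (h.smooth_secondForm v w)
  unfold hopfCoeff
  exact (((hc 1 1).sub (hc I I)).sub (contDiffOn_const.mul (hc 1 I))).div_const _

/-- The Codazzi equation. -/
theorem codazzi (h : ConformalOn X Ω) (hz : z ∈ Ω) :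
    pd 1 (hopfCoeff X) z + I * pd I (hopfCoeff X) z
      = (conformalFactor X z / 2 : ℝ)
        * ((pd 1 (meanCurvature X) z : ℝ) - I * (pd I (meanCurvature X) z : ℝ)) := by
  have hd : ∀ v w, DifferentiableAt ℝ (fun y => secondForm X y v w) z := fun v w =>
    differentiableAt_of_mem h.isOpen (h.smooth_secondForm v w) hz
  have hdc : ∀ v w, DifferentiableAt ℝ (fun y => (secondForm X y v w : ℂ)) z := fun v w =>
    Complex.ofRealCLM.differentiableAt.comp z (hd v w)
  have hH := differentiableAt_of_mem h.isOpen h.smooth_meanCurvature hz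
  have hQ : ∀ v, pd v (hopfCoeff X) z
      = ((pd v (fun y => secondForm X y 1 1) z : ℝ) - (pd v (fun y => secondForm X y I I) z : ℝ)
        - 2 * I * (pd v (fun y => secondForm X y 1 I) z : ℝ)) / 4 := by
    intro v
    have : hopfCoeff X = fun y => (1 / 4 : ℂ) * (((secondForm X y 1 1 : ℂ) - (secondForm X y I I : ℂ))
        - (2 * I) * (secondForm X y 1 I : ℂ)) := by
      ext y; rw [hopfCoeff]; ring
    rw [this, pd_const_mul (((hdc _ _).fun_sub (hdc _ _)).fun_sub ((hdc _ _).const_mul _)),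
      pd_sub ((hdc _ _).fun_sub (hdc _ _)) ((hdc _ _).const_mul _), pd_sub (hdc _ _) (hdc _ _),
      pd_const_mul (hdc _ _), pd_ofReal (hd _ _), pd_ofReal (hd _ _), pd_ofReal (hd _ _)]
    ring
  -- The derivative of the trace L + N = 2EH. It trades the sum of the diagonal coefficients for H,
  -- and the terms in H dE then cancel against those of the two real Codazzi equations.
  have htr : ∀ v, pd v (fun y => secondForm X y 1 1) z + pd v (fun y => secondForm X y I I) z
      = 2 * (pd v (meanCurvature X) z * conformalFactor X z
        + meanCurvature X z * pd v (conformalFactor X) z) := by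
    intro v
    rw [← pd_add (hd _ _) (hd _ _), ← pd_mul hH (h.diff_conformalFactor hz),
      ← pd_const_mul (hH.fun_mul (h.diff_conformalFactor hz))]
    refine pd_congr h.isOpen (fun y hy => ?_) v hz
    have hp := (h.pos y hy).ne'
    rw [h.meanCurvature_eq hy]
    field_simp
  have c1 := h.codazzi_aux₁ hz
  have c2 := h.codazzi_aux₂ hz
  rw [hQ, hQ]
  apply Complex.ext
  · simp
    linarith [htr 1]
  · simp
    linarith [htr I]

end ConformalOn

/-! ### Restriction and scaling of conformal surfaces. -/

namespace ConformalOn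

variable {X Y : ℂ → E3} {Ω Ω' : Set ℂ} {z : ℂ}

theorem mono (h : ConformalOn X Ω) (ho : IsOpen Ω') (hs : Ω' ⊆ Ω) : ConformalOn X Ω' :=
  ⟨ho, h.smooth.mono hs, fun z hz => h.pos z (hs hz), fun z hz => h.eq z (hs hz),
    fun z hz => h.orth z (hs hz)⟩

theorem pd_smul_left (X : ℂ → E3) (r : ℝ) (v z : ℂ) : pd v (fun y => r • X y) z = r • pd v X z := by
  rw [pd, show (fun y => r • X y) = r • X from rfl, fderiv_const_smul_field]; rfl

theorem firstForm_smul (X : ℂ → E3) (r : ℝ) (z v w : ℂ) :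
    firstForm (fun y => r • X y) z v w = r ^ 2 * firstForm X z v w := by
  change inner ℝ (pd v (fun y => r • X y) z) (pd w (fun y => r • X y) z) = _
  rw [pd_smul_left, pd_smul_left, real_inner_smul_left, real_inner_smul_right, ← mul_assoc, ← sq]
  rfl

theorem conformalFactor_smul (X : ℂ → E3) (r : ℝ) (z : ℂ) :
    conformalFactor (fun y => r • X y) z = r ^ 2 * conformalFactor X z := firstForm_smul X r z 1 1

/-- Scaling a conformally parametrized surface. -/
theorem smul (h : ConformalOn X Ω) {r : ℝ} (hr : r ≠ 0) : ConformalOn (fun y => r • X y) Ω where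
  isOpen := h.isOpen
  smooth := contDiffOn_const.fun_smul h.smooth
  pos z hz := by
    rw [conformalFactor_smul]
    have := h.pos z hz
    positivity
  eq z hz := by rw [conformalFactor_smul, firstForm_smul, h.eq z hz]
  orth z hz := by rw [firstForm_smul, h.orth z hz, mul_zero]

theorem unitNormal_smul (h : ConformalOn X Ω) {r : ℝ} (hr : r ≠ 0) (hz : z ∈ Ω) :
    unitNormal (fun y => r • X y) z = unitNormal X z := by
  rw [(h.smul hr).unitNormal_eq hz, h.unitNormal_eq hz, pd_smul_left, pd_smul_left,
    conformalFactor_smul]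
  simp only [cross3, WithLp.ofLp_smul, map_smul, LinearMap.smul_apply, WithLp.toLp_smul, smul_smul]
  congr 1
  have := (h.pos z hz).ne'
  field_simp

theorem secondForm_smul (h : ConformalOn X Ω) {r : ℝ} (hr : r ≠ 0) (hz : z ∈ Ω) (v w : ℂ) :
    secondForm (fun y => r • X y) z v w = r * secondForm X z v w := by
  rw [(h.smul hr).secondForm_eq hz, h.secondForm_eq hz, h.unitNormal_smul hr hz,
    show pd w (fun y => r • X y) = fun y => r • pd w X y from funext fun y => pd_smul_left X r w y,
    pd_smul_left, real_inner_smul_left]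

theorem hopfCoeff_smul (h : ConformalOn X Ω) {r : ℝ} (hr : r ≠ 0) (hz : z ∈ Ω) :
    hopfCoeff (fun y => r • X y) z = r * hopfCoeff X z := by
  simp only [hopfCoeff, h.secondForm_smul hr hz]
  push_cast
  ring

theorem meanCurvature_smul (h : ConformalOn X Ω) {r : ℝ} (hr : r ≠ 0) (hz : z ∈ Ω) :
    meanCurvature (fun y => r • X y) z = 1 / r * meanCurvature X z := by
  have := (h.pos z hz).ne'
  rw [(h.smul hr).meanCurvature_eq hz, h.meanCurvature_eq hz, h.secondForm_smul hr hz,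
    h.secondForm_smul hr hz, conformalFactor_smul]
  field_simp

/-! ### Change of the coordinate -/

section Change

variable {φ : ℂ → ℂ}

theorem pd_comp (hY : ConformalOn Y Ω') (ho : IsOpen Ω) (hφ : DifferentiableOn ℂ φ Ω)
    (hm : Set.MapsTo φ Ω Ω') (he : Set.EqOn X (Y ∘ φ) Ω) (hz : z ∈ Ω) (v : ℂ) :
    pd v X z = fderiv ℝ Y (φ z) (v * deriv φ z) := by
  have hd : DifferentiableAt ℂ φ z := hφ.differentiableAt (ho.mem_nhds hz)
  rw [pd_congr ho he v hz, pd, fderiv_comp z (hY.diff (hm hz)) (hd.restrictScalars ℝ),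
    ContinuousLinearMap.comp_apply]
  congr 1
  exact pd_holomorphic hd v

theorem fderiv_apply_eq (Y : ℂ → E3) (y c : ℂ) :
    fderiv ℝ Y y c = c.re • pd 1 Y y + c.im • pd I Y y := by
  have : c = c.re • (1 : ℂ) + c.im • I := by simp
  conv_lhs => rw [this, map_add, map_smul, map_smul]
  rfl

theorem normSq_deriv_pos (hX : ConformalOn X Ω) (hY : ConformalOn Y Ω')
    (hφ : DifferentiableOn ℂ φ Ω) (hm : Set.MapsTo φ Ω Ω') (he : Set.EqOn X (Y ∘ φ) Ω)
    (hz : z ∈ Ω) : 0 < Complex.normSq (deriv φ z) := by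
  rw [Complex.normSq_pos]
  intro h0
  have := hX.pos z hz
  rw [← inner_xx, hY.pd_comp hX.isOpen hφ hm he hz, h0] at this
  simp at this

theorem conformalFactor_comp (hX : ConformalOn X Ω) (hY : ConformalOn Y Ω')
    (hφ : DifferentiableOn ℂ φ Ω) (hm : Set.MapsTo φ Ω Ω') (he : Set.EqOn X (Y ∘ φ) Ω)
    (hz : z ∈ Ω) :
    conformalFactor X z = Complex.normSq (deriv φ z) * conformalFactor Y (φ z) := by
  rw [← inner_xx X, hY.pd_comp hX.isOpen hφ hm he hz, fderiv_apply_eq, one_mul]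
  simp only [inner_add_left, inner_add_right, real_inner_smul_left, real_inner_smul_right,
    hY.inner_yy (hm hz), hY.inner_xy (hm hz), inner_xx,
    real_inner_comm (pd 1 Y (φ z)) (pd I Y (φ z)), Complex.normSq_apply]
  ring

/-- A holomorphic change of coordinate has Jacobian |φ'|² > 0: it multiplies X_x × X_y by a positive
factor and preserves the orientation. -/
theorem unitNormal_comp (hX : ConformalOn X Ω) (hY : ConformalOn Y Ω')
    (hφ : DifferentiableOn ℂ φ Ω) (hm : Set.MapsTo φ Ω Ω') (he : Set.EqOn X (Y ∘ φ) Ω)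
    (hz : z ∈ Ω) : unitNormal X z = unitNormal Y (φ z) := by
  have hp := normSq_deriv_pos hX hY hφ hm he hz
  have hp' := hY.pos _ (hm hz)
  rw [hX.unitNormal_eq hz, hY.unitNormal_eq (hm hz), conformalFactor_comp hX hY hφ hm he hz,
    hY.pd_comp hX.isOpen hφ hm he hz, hY.pd_comp hX.isOpen hφ hm he hz, fderiv_apply_eq,
    fderiv_apply_eq]
  have : cross3 ((1 * deriv φ z).re • pd 1 Y (φ z) + (1 * deriv φ z).im • pd I Y (φ z))
      ((I * deriv φ z).re • pd 1 Y (φ z) + (I * deriv φ z).im • pd I Y (φ z))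
      = Complex.normSq (deriv φ z) • cross3 (pd 1 Y (φ z)) (pd I Y (φ z)) := by
    simp only [cross3, WithLp.ofLp_smul, WithLp.ofLp_add, map_smul, map_add, LinearMap.add_apply,
      LinearMap.smul_apply, cross_self, ← WithLp.toLp_smul]
    congr 1
    ext i
    have hi := congrFun (cross_anticomm (pd 1 Y (φ z)).ofLp (pd I Y (φ z)).ofLp) i
    rw [Pi.neg_apply] at hi
    simp [Complex.normSq_apply]
    linear_combination (deriv φ z).im ^ 2 * hi
  rw [this, smul_smul]
  congr 1
  field_simp

theorem secondForm_bilin (hY : ConformalOn Y Ω') {y : ℂ} (hy : y ∈ Ω') (c d : ℂ) :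
    secondForm Y y c d = c.re * d.re * secondForm Y y 1 1
      + (c.re * d.im + c.im * d.re) * secondForm Y y 1 I + c.im * d.im * secondForm Y y I I := by
  have hc : c = c.re • (1 : ℂ) + c.im • I := by simp
  have hd : d = d.re • (1 : ℂ) + d.im • I := by simp
  have h := hY.secondForm_yx hy
  simp only [secondForm] at h ⊢
  conv_lhs => rw [hc, hd]
  simp only [map_add, map_smul, _root_.add_apply, _root_.smul_apply,
    inner_add_left, real_inner_smul_left, h]
  ring

/-- The chain rule for second derivatives has an extra term dY(v w φ''); it is tangential, so the
normal does not see it. -/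
theorem secondForm_comp (hX : ConformalOn X Ω) (hY : ConformalOn Y Ω')
    (hφ : DifferentiableOn ℂ φ Ω) (hm : Set.MapsTo φ Ω Ω') (he : Set.EqOn X (Y ∘ φ) Ω)
    (hz : z ∈ Ω) (v w : ℂ) :
    secondForm X z v w = secondForm Y (φ z) (v * deriv φ z) (w * deriv φ z) := by
  have ho := hX.isOpen
  have hd : DifferentiableAt ℂ φ z := hφ.differentiableAt (ho.mem_nhds hz)
  have hd' : DifferentiableAt ℂ (fun y => w * deriv φ y) z :=
    ((hφ.deriv ho).differentiableAt (ho.mem_nhds hz)).const_mul w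
  have h1 := differentiableAt_of_mem hY.isOpen (hY.smooth.fderiv_infty hY.isOpen) (hm hz)
  have h2 : HasFDerivAt (fun y => fderiv ℝ Y (φ y) (w * deriv φ y)) _ z :=
    (h1.hasFDerivAt.comp z (hd.restrictScalars ℝ).hasFDerivAt).clm_apply
      (hd'.restrictScalars ℝ).hasFDerivAt
  rw [hX.secondForm_eq hz, unitNormal_comp hX hY hφ hm he hz,
    pd_congr ho (fun y hy => hY.pd_comp ho hφ hm he hy w) v hz, pd, h2.fderiv]
  have h3 : fderiv ℝ φ z v = v * deriv φ z := pd_holomorphic hd v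
  simp only [_root_.add_apply, ContinuousLinearMap.comp_apply,
    ContinuousLinearMap.flip_apply, Function.comp_apply, inner_add_left, h3]
  rw [fderiv_apply_eq, inner_add_left, real_inner_smul_left, real_inner_smul_left,
    real_inner_comm, hY.inner_nx (hm hz), real_inner_comm, hY.inner_ny (hm hz)]
  simp [secondForm]

theorem hopfCoeff_comp (hX : ConformalOn X Ω) (hY : ConformalOn Y Ω')
    (hφ : DifferentiableOn ℂ φ Ω) (hm : Set.MapsTo φ Ω Ω') (he : Set.EqOn X (Y ∘ φ) Ω)
    (hz : z ∈ Ω) : hopfCoeff X z = deriv φ z ^ 2 * hopfCoeff Y (φ z) := by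
  simp only [hopfCoeff, secondForm_comp hX hY hφ hm he hz]
  rw [hY.secondForm_bilin (hm hz) (1 * deriv φ z) (1 * deriv φ z),
    hY.secondForm_bilin (hm hz) (I * deriv φ z) (I * deriv φ z),
    hY.secondForm_bilin (hm hz) (1 * deriv φ z) (I * deriv φ z)]
  apply Complex.ext <;> simp [sq] <;> ring

theorem meanCurvature_comp (hX : ConformalOn X Ω) (hY : ConformalOn Y Ω')
    (hφ : DifferentiableOn ℂ φ Ω) (hm : Set.MapsTo φ Ω Ω') (he : Set.EqOn X (Y ∘ φ) Ω)
    (hz : z ∈ Ω) : meanCurvature X z = meanCurvature Y (φ z) := by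
  have hp := normSq_deriv_pos hX hY hφ hm he hz
  have hp' := hY.pos _ (hm hz)
  rw [hX.meanCurvature_eq hz, hY.meanCurvature_eq (hm hz), secondForm_comp hX hY hφ hm he hz,
    secondForm_comp hX hY hφ hm he hz,
    hY.secondForm_bilin (hm hz) (1 * deriv φ z) (1 * deriv φ z),
    hY.secondForm_bilin (hm hz) (I * deriv φ z) (I * deriv φ z),
    conformalFactor_comp hX hY hφ hm he hz]
  field_simp
  simp [Complex.normSq_apply]
  ring

end Change

/-! ### Surfaces with the same fundamental forms -/

/-- The linear map that carries the moving frame of `X` to the moving frame of `Y`. -/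
noncomputable def frameMap (X Y : ℂ → E3) (z : ℂ) : E3 →L[ℝ] E3 :=
  ((innerSL ℝ ((conformalFactor X z)⁻¹ • pd 1 X z)).smulRight (pd 1 Y z)
    + (innerSL ℝ ((conformalFactor X z)⁻¹ • pd I X z)).smulRight (pd I Y z))
    + (innerSL ℝ (unitNormal X z)).smulRight (unitNormal Y z)

theorem frameMap_apply (X Y : ℂ → E3) (z : ℂ) (u : E3) :
    frameMap X Y z u = ((conformalFactor X z)⁻¹ * inner ℝ (pd 1 X z) u) • pd 1 Y z
      + ((conformalFactor X z)⁻¹ * inner ℝ (pd I X z) u) • pd I Y z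
      + inner ℝ (unitNormal X z) u • unitNormal Y z := by
  simp [frameMap]

theorem frameMap_x (hX : ConformalOn X Ω) (hz : z ∈ Ω) : frameMap X Y z (pd 1 X z) = pd 1 Y z := by
  rw [frameMap_apply, hX.inner_nx hz, inner_xx, real_inner_comm, hX.inner_xy hz,
    inv_mul_cancel₀ (hX.pos z hz).ne']
  simp

theorem frameMap_y (hX : ConformalOn X Ω) (hz : z ∈ Ω) : frameMap X Y z (pd I X z) = pd I Y z := by
  rw [frameMap_apply, hX.inner_ny hz, hX.inner_yy hz, hX.inner_xy hz,
    inv_mul_cancel₀ (hX.pos z hz).ne']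
  simp

theorem frameMap_n (hX : ConformalOn X Ω) (hz : z ∈ Ω) :
    frameMap X Y z (unitNormal X z) = unitNormal Y z := by
  rw [frameMap_apply, hX.inner_nn hz, real_inner_comm, hX.inner_nx hz, real_inner_comm,
    hX.inner_ny hz]
  simp

/-- A linear map is determined by its values on the moving frame. -/
theorem clm_ext (hX : ConformalOn X Ω) (hz : z ∈ Ω) {S T : E3 →L[ℝ] E3}
    (h1 : S (pd 1 X z) = T (pd 1 X z)) (h2 : S (pd I X z) = T (pd I X z))
    (h3 : S (unitNormal X z) = T (unitNormal X z)) : S = T := by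
  -- Carrying the frame of X to itself is the frame expansion of a vector, so every u is an explicit
  -- combination of X_x, X_y and n.
  have hid : frameMap X X z = ContinuousLinearMap.id ℝ E3 := by
    ext1 u
    have hp := (hX.pos z hz).ne'
    refine hX.ext hz ?_ ?_ ?_ <;>
      simp only [frameMap_apply, inner_add_left, real_inner_smul_left, inner_xx, hX.inner_yy hz,
        hX.inner_xy hz, hX.inner_nx hz, hX.inner_ny hz, hX.inner_nn hz,
        real_inner_comm (pd 1 X z) (pd I X z), real_inner_comm (unitNormal X z) (pd 1 X z),
        real_inner_comm (unitNormal X z) (pd I X z), ContinuousLinearMap.id_apply] <;>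
      simp [real_inner_comm]
    all_goals field_simp
  ext1 u
  have hu : frameMap X X z u = u := by rw [hid]; rfl
  rw [← hu, frameMap_apply]
  simp only [map_add, map_smul, h1, h2, h3]

theorem inner_frameMap_x (hX : ConformalOn X Ω) (hY : ConformalOn Y Ω) (hz : z ∈ Ω)
    (hE : Set.EqOn (conformalFactor Y) (conformalFactor X) Ω) (u : E3) :
    inner ℝ (frameMap X Y z u) (pd 1 Y z) = (inner ℝ u (pd 1 X z) : ℝ) := by
  have hp := (hX.pos z hz).ne'
  rw [frameMap_apply, inner_add_left, inner_add_left, real_inner_smul_left, real_inner_smul_left,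
    real_inner_smul_left, inner_xx, hE hz, hY.inner_nx hz, real_inner_comm (pd 1 Y z) (pd I Y z),
    hY.inner_xy hz, real_inner_comm u (pd 1 X z)]
  field_simp
  ring

theorem inner_frameMap_y (hX : ConformalOn X Ω) (hY : ConformalOn Y Ω) (hz : z ∈ Ω)
    (hE : Set.EqOn (conformalFactor Y) (conformalFactor X) Ω) (u : E3) :
    inner ℝ (frameMap X Y z u) (pd I Y z) = (inner ℝ u (pd I X z) : ℝ) := by
  have hp := (hX.pos z hz).ne'
  rw [frameMap_apply, inner_add_left, inner_add_left, real_inner_smul_left, real_inner_smul_left,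
    real_inner_smul_left, hY.inner_yy hz, hE hz, hY.inner_ny hz,
    hY.inner_xy hz, real_inner_comm u (pd I X z)]
  field_simp
  ring

theorem inner_frameMap_n (hX : ConformalOn X Ω) (hY : ConformalOn Y Ω) (hz : z ∈ Ω) (u : E3) :
    inner ℝ (frameMap X Y z u) (unitNormal Y z) = (inner ℝ u (unitNormal X z) : ℝ) := by
  have hp := (hX.pos z hz).ne'
  rw [frameMap_apply, inner_add_left, inner_add_left, real_inner_smul_left, real_inner_smul_left,
    real_inner_smul_left, hY.inner_nn hz, real_inner_comm (unitNormal Y z), hY.inner_nx hz,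
    real_inner_comm (unitNormal Y z), hY.inner_ny hz, real_inner_comm u (unitNormal X z)]
  ring

theorem inner_frameMap (hX : ConformalOn X Ω) (hY : ConformalOn Y Ω) (hz : z ∈ Ω)
    (hE : Set.EqOn (conformalFactor Y) (conformalFactor X) Ω) (u v : E3) :
    inner ℝ (frameMap X Y z u) (frameMap X Y z v) = (inner ℝ u v : ℝ) := by
  rw [hY.inner_eq hz, hX.inner_eq hz u, inner_frameMap_x hX hY hz hE, inner_frameMap_x hX hY hz hE,
    inner_frameMap_y hX hY hz hE, inner_frameMap_y hX hY hz hE, inner_frameMap_n hX hY hz,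
    inner_frameMap_n hX hY hz, hE hz]


end ConformalOn

namespace ConformalOn

variable {X Y : ℂ → E3} {Ω : Set ℂ} {z : ℂ}

theorem smooth_frameMap (hX : ConformalOn X Ω) (hY : ConformalOn Y Ω) :
    ContDiffOn ℝ ∞ (frameMap X Y) Ω := by
  have hE : ContDiffOn ℝ ∞ (fun z => (conformalFactor X z)⁻¹) Ω :=
    hX.smooth_conformalFactor.inv fun z hz => (hX.pos z hz).ne'
  have key : ∀ {a b : ℂ → E3}, ContDiffOn ℝ ∞ a Ω → ContDiffOn ℝ ∞ b Ω →
      ContDiffOn ℝ ∞ (fun z => (innerSL ℝ (a z)).smulRight (b z)) Ω := fun ha hb =>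
    ((innerSL ℝ).contDiff.comp_contDiffOn ha).smulRight hb
  exact ((key (hE.smul (hX.smooth_pd 1)) (hY.smooth_pd 1)).add
    (key (hE.smul (hX.smooth_pd I)) (hY.smooth_pd I))).add
    (key hX.smooth_unitNormal hY.smooth_unitNormal)

theorem secondForm_eq_of_data (hX : ConformalOn X Ω) (hY : ConformalOn Y Ω) (hz : z ∈ Ω)
    (hE : conformalFactor Y z = conformalFactor X z)
    (hH : meanCurvature Y z = meanCurvature X z) (hQ : hopfCoeff Y z = hopfCoeff X z) :
    secondForm Y z 1 1 = secondForm X z 1 1 ∧ secondForm Y z 1 I = secondForm X z 1 I ∧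
      secondForm Y z I I = secondForm X z I I := by
  have hp := (hX.pos z hz).ne'
  rw [hX.meanCurvature_eq hz, hY.meanCurvature_eq hz, hE] at hH
  field_simp at hH
  have h1 := congrArg Complex.re hQ
  have h2 := congrArg Complex.im hQ
  simp [hopfCoeff] at h1 h2
  exact ⟨by linarith, by linarith, by linarith⟩

/-- If two surfaces have the same data `e ^ ω, H, Q`, the map between the frames is constant. -/
theorem fderiv_frameMap (hX : ConformalOn X Ω) (hY : ConformalOn Y Ω)
    (hE : Set.EqOn (conformalFactor Y) (conformalFactor X) Ω)
    (hH : Set.EqOn (meanCurvature Y) (meanCurvature X) Ω)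
    (hQ : Set.EqOn (hopfCoeff Y) (hopfCoeff X) Ω) (hz : z ∈ Ω) :
    fderiv ℝ (frameMap X Y) z = 0 := by
  have ho := hX.isOpen
  have hT := differentiableAt_of_mem ho (smooth_frameMap hX hY) hz
  -- If T a = b along Ω, the product rule gives T' a = b' − T a'. So T' kills a frame vector once T
  -- is known to carry its derivative to that of the corresponding frame vector of Y. The
  -- Gauss–Weingarten components of these derivatives involve only E, dE and the second form, which
  -- E, H and Q determine.
  have key : ∀ (v : ℂ) {a b : ℂ → E3}, DifferentiableAt ℝ a z →
      (∀ y ∈ Ω, frameMap X Y y (a y) = b y) → frameMap X Y z (pd v a z) = pd v b z →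
      pd v (frameMap X Y) z (a z) = 0 := by
    intro v a b ha hab h
    rw [← pd_congr ho (f := fun y => frameMap X Y y (a y)) (g := b) hab v hz, pd, pd,
      fderiv_clm_apply hT ha] at h
    simpa [pd] using h
  obtain ⟨hL, hM, hP⟩ := secondForm_eq_of_data hX hY hz (hE hz) (hH hz) (hQ hz)
  have hE' : ∀ v, pd v (conformalFactor Y) z = pd v (conformalFactor X) z := fun v =>
    pd_congr ho hE v hz
  have hxx : frameMap X Y z (pd 1 (pd 1 X) z) = pd 1 (pd 1 Y) z := by
    refine hY.ext hz ?_ ?_ ?_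
    · rw [inner_frameMap_x hX hY hz hE, hX.xx_x hz, hY.xx_x hz, hE']
    · rw [inner_frameMap_y hX hY hz hE, hX.xx_y hz, hY.xx_y hz, hE']
    · rw [inner_frameMap_n hX hY hz, ← hX.secondForm_eq hz, ← hY.secondForm_eq hz, hL]
  have hxy : frameMap X Y z (pd 1 (pd I X) z) = pd 1 (pd I Y) z := by
    refine hY.ext hz ?_ ?_ ?_
    · rw [inner_frameMap_x hX hY hz hE, hX.xy_x hz, hY.xy_x hz, hE']
    · rw [inner_frameMap_y hX hY hz hE, hX.xy_y hz, hY.xy_y hz, hE']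
    · rw [inner_frameMap_n hX hY hz, ← hX.secondForm_eq hz, ← hY.secondForm_eq hz, hM]
  have hyy : frameMap X Y z (pd I (pd I X) z) = pd I (pd I Y) z := by
    refine hY.ext hz ?_ ?_ ?_
    · rw [inner_frameMap_x hX hY hz hE, hX.yy_x hz, hY.yy_x hz, hE']
    · rw [inner_frameMap_y hX hY hz hE, hX.yy_y hz, hY.yy_y hz, hE']
    · rw [inner_frameMap_n hX hY hz, ← hX.secondForm_eq hz, ← hY.secondForm_eq hz, hP]
  have hn : ∀ v, secondForm Y z v 1 = secondForm X z v 1 → secondForm Y z v I = secondForm X z v I →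
      frameMap X Y z (pd v (unitNormal X) z) = pd v (unitNormal Y) z := by
    intro v h1 h2
    refine hY.ext hz ?_ ?_ ?_
    · rw [inner_frameMap_x hX hY hz hE, hX.pd_n_x hz, hY.pd_n_x hz, h1]
    · rw [inner_frameMap_y hX hY hz hE, hX.pd_n_y hz, hY.pd_n_y hz, h2]
    · rw [inner_frameMap_n hX hY hz, hX.pd_n_n hz, hY.pd_n_n hz]
  have fx := fun y hy => frameMap_x (Y := Y) hX (z := y) hy
  have fy := fun y hy => frameMap_y (Y := Y) hX (z := y) hy
  have fn := fun y hy => frameMap_n (Y := Y) hX (z := y) hy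
  have final : ∀ v, pd v (frameMap X Y) z (pd 1 X z) = 0 → pd v (frameMap X Y) z (pd I X z) = 0 →
      pd v (frameMap X Y) z (unitNormal X z) = 0 → pd v (frameMap X Y) z = 0 := by
    intro v h1 h2 h3
    exact hX.clm_ext hz (by simpa using h1) (by simpa using h2) (by simpa using h3)
  apply fderiv_eq_zero_of_pd
  · refine final 1 (key 1 (hX.diff_pd hz 1) fx hxx) (key 1 (hX.diff_pd hz I) fy hxy)
      (key 1 (hX.diff_unitNormal hz) fn (hn 1 hL hM))
  · refine final I (key I (hX.diff_pd hz 1) fx ?_) (key I (hX.diff_pd hz I) fy hyy)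
      (key I (hX.diff_unitNormal hz) fn (hn I ?_ hP))
    · rw [hX.pd_yx hz, hY.pd_yx hz, hxy]
    · rw [hX.secondForm_yx hz, hY.secondForm_yx hz, hM]

/-- A change of coordinate acts on the tangent frames of both surfaces by the same real matrix and
fixes both normals. The frame map is therefore a well-defined function on the Riemann surface. -/
theorem frameMap_comp {Ω' : Set ℂ} {X' Y' : ℂ → E3} {φ : ℂ → ℂ} (hX : ConformalOn X Ω)
    (hX' : ConformalOn X' Ω') (hY : ConformalOn Y Ω) (hY' : ConformalOn Y' Ω')
    (hφ : DifferentiableOn ℂ φ Ω) (hm : Set.MapsTo φ Ω Ω') (heX : Set.EqOn X (X' ∘ φ) Ω)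
    (heY : Set.EqOn Y (Y' ∘ φ) Ω) (hz : z ∈ Ω) :
    frameMap X Y z = frameMap X' Y' (φ z) := by
  refine hX.clm_ext hz ?_ ?_ ?_
  · rw [frameMap_x hX hz, hX'.pd_comp hX.isOpen hφ hm heX hz, hY'.pd_comp hX.isOpen hφ hm heY hz,
      fderiv_apply_eq, fderiv_apply_eq, map_add, map_smul, map_smul, frameMap_x hX' (hm hz),
      frameMap_y hX' (hm hz)]
  · rw [frameMap_y hX hz, hX'.pd_comp hX.isOpen hφ hm heX hz, hY'.pd_comp hX.isOpen hφ hm heY hz,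
      fderiv_apply_eq, fderiv_apply_eq, map_add, map_smul, map_smul, frameMap_x hX' (hm hz),
      frameMap_y hX' (hm hz)]
  · rw [frameMap_n hX hz, unitNormal_comp hX hX' hφ hm heX hz,
      unitNormal_comp hY hY' hφ hm heY hz, frameMap_n hX' (hm hz)]

theorem inner_fderiv (h : ConformalOn X Ω) (hz : z ∈ Ω) (v w : ℂ) :
    firstForm X z v w = conformalFactor X z * inner ℝ v w := by
  simp only [firstForm, fderiv_apply_eq, inner_add_left, inner_add_right, real_inner_smul_left,
    real_inner_smul_right, h.inner_yy hz, h.inner_xy hz, inner_xx,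
    real_inner_comm (pd 1 X z) (pd I X z), Complex.inner]
  simp
  ring

theorem conformalAt (h : ConformalOn X Ω) (hz : z ∈ Ω) : ConformalAt X z :=
  conformalAt_iff'.2 ⟨_, h.pos z hz, h.inner_fderiv hz⟩

end ConformalOn

/-! ### Passage to the Riemann surface, and congruence of surfaces with equal data. -/

section Manifold

variable {M : Type*} [TopologicalSpace M] [ChartedSpace ℂ M]

theorem IsConformalImmersion.conformalOn {F : M → E3} (hF : IsConformalImmersion F)
    {e : OpenPartialHomeomorph M ℂ} (he : e ∈ complexCoords M) :
    ConformalOn (F ∘ e.symm) e.target := by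
  have key : ∀ z ∈ e.target, ∃ c : ℝ, 0 < c ∧ ∀ v w : ℂ, firstForm (F ∘ e.symm) z v w
      = c * inner ℝ v w := fun z hz => conformalAt_iff'.1 (hF.conformal e he z hz)
  refine ⟨e.open_target, hF.smooth e he, fun z hz => ?_, fun z hz => ?_, fun z hz => ?_⟩ <;>
    obtain ⟨c, hc, h⟩ := key z hz
  · rw [conformalFactor, h]; simpa [Complex.inner] using hc
  · rw [conformalFactor, h, h]; simp
  · rw [h]; simp [Complex.inner]

theorem differentiableOn_transition {e e' : OpenPartialHomeomorph M ℂ} (he : e ∈ complexCoords M)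
    (he' : e' ∈ complexCoords M) :
    DifferentiableOn ℂ (e' ∘ e.symm) (e.target ∩ e.symm ⁻¹' e'.source) := by
  have h := IsManifold.compatible_of_mem_maximalAtlas he he'
  rw [contDiffGroupoid, mem_groupoid_of_pregroupoid] at h
  have h1 := h.1
  simp only [contDiffPregroupoid, modelWithCornersSelf_coe, modelWithCornersSelf_coe_symm,
    Function.comp_id, Function.id_comp, Set.preimage_id, Set.range_id, Set.inter_univ] at h1
  exact (ContDiffOn.differentiableOn h1 (by simp))

/-- A change of coordinates, in the form used by the local transformation formulas. -/
theorem transition_spec {e e' : OpenPartialHomeomorph M ℂ} (he : e ∈ complexCoords M)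
    (he' : e' ∈ complexCoords M) :
    IsOpen (e.target ∩ e.symm ⁻¹' e'.source) ∧
    DifferentiableOn ℂ (e' ∘ e.symm) (e.target ∩ e.symm ⁻¹' e'.source) ∧
    Set.MapsTo (e' ∘ e.symm) (e.target ∩ e.symm ⁻¹' e'.source) e'.target ∧
    ∀ {α : Type} (F : M → α), Set.EqOn (F ∘ e.symm) ((F ∘ e'.symm) ∘ (e' ∘ e.symm))
      (e.target ∩ e.symm ⁻¹' e'.source) := by
  refine ⟨e.symm.isOpen_inter_preimage e'.open_source, differentiableOn_transition he he',
    fun z hz => e'.map_source hz.2, fun F z hz => ?_⟩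
  simp only [Function.comp_apply]
  rw [e'.left_inv hz.2]

theorem chart_mem [IsManifold 𝓘(ℂ) ω M] (p : M) : chartAt ℂ p ∈ complexCoords M :=
  IsManifold.chart_mem_maximalAtlas p

/-- A function whose derivative vanishes in local coordinates is constant. -/
theorem eq_of_fderiv_eq_zero [PreconnectedSpace M] {V : Type*} [NormedAddCommGroup V]
    [NormedSpace ℝ V] {g : M → V}
    (hg : ∀ p : M, ∃ U ∈ nhds (chartAt ℂ p p), ∀ z ∈ U,
      DifferentiableAt ℝ (g ∘ (chartAt ℂ p).symm) z ∧ fderiv ℝ (g ∘ (chartAt ℂ p).symm) z = 0)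
    (p q : M) : g p = g q := by
  have : IsLocallyConstant g := by
    rw [IsLocallyConstant.iff_eventually_eq]
    intro p
    obtain ⟨U, hU, h⟩ := hg p
    obtain ⟨ε, hε, hb⟩ := Metric.mem_nhds_iff.1 hU
    have hc : ∀ z ∈ Metric.ball (chartAt ℂ p p) ε,
        (g ∘ (chartAt ℂ p).symm) z = (g ∘ (chartAt ℂ p).symm) (chartAt ℂ p p) := fun z hz =>
      Metric.isOpen_ball.is_const_of_fderiv_eq_zero (convex_ball _ _).isPreconnected
        (fun y hy => (h y (hb hy)).1.differentiableWithinAt) (fun y hy => (h y (hb hy)).2) hz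
        (Metric.mem_ball_self hε)
    have hcont := (chartAt ℂ p).continuousAt (mem_chart_source ℂ p)
    filter_upwards [(chartAt ℂ p).open_source.mem_nhds (mem_chart_source ℂ p),
      hcont (Metric.ball_mem_nhds _ hε)] with y hy hy'
    have := hc _ hy'
    simp only [Function.comp_apply] at this
    rwa [(chartAt ℂ p).left_inv hy, (chartAt ℂ p).left_inv (mem_chart_source ℂ p)] at this
  exact this.apply_eq_of_preconnectedSpace p q

open ConformalOn in
/-- Surfaces with the same data `e ^ ω, H, Q` are congruent. -/
theorem congruent_of_data [ConnectedSpace M] [IsManifold 𝓘(ℂ) ω M] {F G : M → E3}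
    (hF : ∀ e ∈ complexCoords M, ConformalOn (F ∘ e.symm) e.target)
    (hG : ∀ e ∈ complexCoords M, ConformalOn (G ∘ e.symm) e.target)
    (hdata : ∀ e ∈ complexCoords M, ∀ z ∈ e.target,
      conformalFactor (G ∘ e.symm) z = conformalFactor (F ∘ e.symm) z ∧
      meanCurvature (G ∘ e.symm) z = meanCurvature (F ∘ e.symm) z ∧
      hopfCoeff (G ∘ e.symm) z = hopfCoeff (F ∘ e.symm) z) : CongruentSurfaces F G := by
  let T : M → E3 →L[ℝ] E3 := fun p =>
    frameMap (F ∘ (chartAt ℂ p).symm) (G ∘ (chartAt ℂ p).symm) (chartAt ℂ p p)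
  have hT : ∀ e ∈ complexCoords M, ∀ z ∈ e.target,
      T (e.symm z) = frameMap (F ∘ e.symm) (G ∘ e.symm) z := by
    intro e he z hz
    obtain ⟨h1, h2, h3, h4⟩ := transition_spec he (chart_mem (e.symm z))
    have hs : e.target ∩ e.symm ⁻¹' (chartAt ℂ (e.symm z)).source ⊆ e.target :=
      Set.inter_subset_left
    exact (frameMap_comp ((hF e he).mono h1 hs) (hF _ (chart_mem _)) ((hG e he).mono h1 hs)
      (hG _ (chart_mem _)) h2 h3 (h4 F) (h4 G) ⟨hz, mem_chart_source ℂ _⟩).symm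
  have hd : ∀ p : M, ∀ z ∈ (chartAt ℂ p).target,
      DifferentiableAt ℝ (frameMap (F ∘ (chartAt ℂ p).symm) (G ∘ (chartAt ℂ p).symm)) z ∧
      fderiv ℝ (frameMap (F ∘ (chartAt ℂ p).symm) (G ∘ (chartAt ℂ p).symm)) z = 0 := by
    intro p z hz
    have he := chart_mem p
    exact ⟨differentiableAt_of_mem (chartAt ℂ p).open_target
      (smooth_frameMap (hF _ he) (hG _ he)) hz,
      fderiv_frameMap (hF _ he) (hG _ he) (fun y hy => (hdata _ he y hy).1)
        (fun y hy => (hdata _ he y hy).2.1) (fun y hy => (hdata _ he y hy).2.2) hz⟩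
  have hnhds : ∀ p : M, (chartAt ℂ p).target ∈ nhds (chartAt ℂ p p) := fun p =>
    (chartAt ℂ p).open_target.mem_nhds (mem_chart_target ℂ p)
  obtain ⟨p₀⟩ : Nonempty M := inferInstance
  have hconst : ∀ p, T p = T p₀ := fun p => eq_of_fderiv_eq_zero (fun p => by
    refine ⟨_, hnhds p, fun z hz => ?_⟩
    have : T ∘ (chartAt ℂ p).symm =ᶠ[nhds z]
        frameMap (F ∘ (chartAt ℂ p).symm) (G ∘ (chartAt ℂ p).symm) := by
      filter_upwards [(chartAt ℂ p).open_target.mem_nhds hz] with y hy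
      exact hT _ (chart_mem p) y hy
    rw [this.differentiableAt_iff, this.fderiv_eq]
    exact hd p z hz) p p₀
  -- Since T is the constant T p₀ and dG = T dF on the tangent frame, G − T F has zero derivative;
  -- its value is the translation part of the congruence.
  have hb : ∀ p, G p - T p₀ (F p) = G p₀ - T p₀ (F p₀) := fun p =>
    eq_of_fderiv_eq_zero (g := fun p => G p - T p₀ (F p)) (fun p => by
      refine ⟨_, hnhds p, fun z hz => ?_⟩
      have he := chart_mem p
      have hXd := (hF _ he).diff hz
      have hYd := (hG _ he).diff hz
      have hder := hYd.hasFDerivAt.sub ((T p₀).hasFDerivAt.comp z hXd.hasFDerivAt)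
      change HasFDerivAt ((fun p => G p - T p₀ (F p)) ∘ (chartAt ℂ p).symm) _ z at hder
      refine ⟨hder.differentiableAt, ?_⟩
      have hTz := hT _ he z hz
      rw [hconst] at hTz
      apply fderiv_eq_zero_of_pd
      · have := frameMap_x (Y := G ∘ (chartAt ℂ p).symm) (hF _ he) hz
        rw [pd, hder.fderiv, _root_.sub_apply, ContinuousLinearMap.comp_apply, sub_eq_zero, hTz]
        exact this.symm
      · have := frameMap_y (Y := G ∘ (chartAt ℂ p).symm) (hF _ he) hz
        rw [pd, hder.fderiv, _root_.sub_apply, ContinuousLinearMap.comp_apply, sub_eq_zero, hTz]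
        exact this.symm) p p₀
  have hiso : ∀ u, ‖T p₀ u‖ = ‖u‖ := by
    intro u
    have he := chart_mem p₀
    have := inner_frameMap (hF _ he) (hG _ he) (mem_chart_target ℂ p₀)
      (fun y hy => (hdata _ he y hy).1) u u
    rw [real_inner_self_eq_norm_sq, real_inner_self_eq_norm_sq] at this
    exact (sq_eq_sq₀ (norm_nonneg _) (norm_nonneg _)).1 this
  let A : E3 →ₗᵢ[ℝ] E3 := ⟨(T p₀).toLinearMap, hiso⟩
  refine ⟨A.toLinearIsometryEquiv rfl, G p₀ - T p₀ (F p₀), fun p => ?_⟩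
  rw [← hb p, LinearIsometry.toLinearIsometryEquiv_apply]
  change G p = T p₀ (F p) + _
  abel

end Manifold

/-! ### Gluing local functions by monodromy. -/

/-- On a simply connected space, locally defined functions whose differences are locally constant
come from a global function, up to locally constant functions. -/
theorem exists_global_of_locally_const_sub {X ι A : Type*} [TopologicalSpace X]
    [SimplyConnectedSpace X] [LocallyPathConnectedSpace X] [AddCommGroup A]
    (U : ι → Set X) (hU : ∀ i, IsOpen (U i)) (idx : X → ι) (hidx : ∀ x, x ∈ U (idx x))
    (h : ι → X → A)
    (hloc : ∀ i j, ∀ x ∈ U i ∩ U j, ∀ᶠ y in nhds x, h i y - h j y = h i x - h j x) :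
    ∃ H : X → A, ∀ x, ∀ᶠ y in nhds x, H y - h (idx x) y = H x - h (idx x) x := by
  -- The discrete topology makes the bundle below a covering and turns continuity into local
  -- constancy.
  let : TopologicalSpace A := ⊥
  have : DiscreteTopology A := ⟨rfl⟩
  -- A point over x stands for a candidate value H x, recorded in the chart i as v = H x − h i x;
  -- this dictates the coordinate change from i to j. A global H is then a section, obtained by
  -- lifting the identity of the simply connected base.
  let Z : FiberBundleCore ι X A :=
    { baseSet := U
      isOpen_baseSet := hU
      indexAt := idx
      mem_baseSet_at := hidx
      coordChange := fun i j x v => v + (h i x - h j x)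
      coordChange_self := by simp
      continuousOn_coordChange := by
        rintro i j ⟨x, v⟩ ⟨hx, -⟩
        apply ContinuousAt.continuousWithinAt
        rw [ContinuousAt, nhds_discrete A, Filter.tendsto_pure]
        have h1 : ∀ᶠ p : X × A in nhds (x, v), p.2 = v := by
          have : ContinuousAt (Prod.snd : X × A → A) (x, v) := continuous_snd.continuousAt
          rw [ContinuousAt, nhds_discrete A, Filter.tendsto_pure] at this
          exact this
        have h2 : ∀ᶠ p : X × A in nhds (x, v), h i p.1 - h j p.1 = h i x - h j x :=
          (continuous_fst.tendsto (x, v)).eventually (hloc i j x hx)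
        filter_upwards [h1, h2] with p hp1 hp2
        rw [hp1, hp2]
      coordChange_comp := by
        intro i j k x _ v
        abel }
  have hcov : IsCoveringMap Z.proj :=
    IsFiberBundle.isCoveringMap fun x => ⟨Z.localTriv (idx x), hidx x⟩
  obtain ⟨x₀⟩ : Nonempty X := inferInstance
  obtain ⟨s, ⟨-, hs⟩, -⟩ := hcov.existsUnique_continuousMap_lifts (ContinuousMap.id X) x₀
    (⟨x₀, (0 : A)⟩ : Z.TotalSpace) rfl
  have hproj : ∀ x, (s x).1 = x := fun x => congrFun hs x
  -- Recovers the candidate value from its record in the preferred chart.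
  let val : Z.TotalSpace → A := fun p => (show A from p.2) + h (idx p.1) p.1
  have hval : ∀ i (p : Z.TotalSpace), (Z.localTriv i p).2 = val p - h i p.1 := by
    intro i p
    change (show A from p.2) + (h (idx p.1) p.1 - h i p.1) = _
    simp only [val]
    abel
  refine ⟨fun x => val (s x), fun x => ?_⟩
  have hc : ContinuousAt (fun y => (Z.localTriv (idx x) (s y)).2) x := by
    have h1 : ContinuousAt (Z.localTriv (idx x)) (s x) :=
      (Z.localTriv (idx x)).continuousAt (by
        rw [Bundle.Trivialization.mem_source]
        change (s x).1 ∈ U (idx x)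
        rw [hproj]
        exact hidx x)
    exact continuous_snd.continuousAt.comp (h1.comp s.continuous.continuousAt)
  rw [ContinuousAt, nhds_discrete A, Filter.tendsto_pure] at hc
  filter_upwards [hc] with y hy
  rwa [hval, hval, hproj, hproj] at hy

/-! ### Harmonic functions on a Riemann surface -/

theorem laplacian_eq_pd {f : ℂ → ℝ} {Ω : Set ℂ} (ho : IsOpen Ω) (hf : ContDiffOn ℝ ∞ f Ω) {z : ℂ}
    (hz : z ∈ Ω) : Laplacian.laplacian f z
      = pd 1 (pd 1 f) z + pd Complex.I (pd Complex.I f) z := by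
  rw [InnerProductSpace.laplacian_eq_iteratedFDeriv_complexPlane, pd_pd ho hf hz, pd_pd ho hf hz]
  simp [iteratedFDeriv_two_apply]

theorem harmonicOnNhd_of_pd {f : ℂ → ℝ} {Ω : Set ℂ} (ho : IsOpen Ω) (hf : ContDiffOn ℝ ∞ f Ω)
    (h : ∀ z ∈ Ω, pd 1 (pd 1 f) z + pd Complex.I (pd Complex.I f) z = 0) :
    InnerProductSpace.HarmonicOnNhd f Ω := by
  intro z hz
  refine ⟨(smoothAt_of_mem ho hf hz).of_le ENat.LEInfty.out, ?_⟩
  filter_upwards [ho.mem_nhds hz] with y hy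
  rw [laplacian_eq_pd ho hf hy, h y hy]
  rfl

theorem pd_log {f : ℂ → ℝ} {z : ℂ} (hf : DifferentiableAt ℝ f z) (h0 : f z ≠ 0) (v : ℂ) :
    pd v (fun y => Real.log (f y)) z = pd v f z / f z := by
  rw [pd, (hf.hasFDerivAt.log h0).fderiv]
  simp [pd, div_eq_inv_mul]

namespace ConformalOn

variable {X Y : ℂ → E3} {Ω : Set ℂ} {z : ℂ}

/-- The Gauss equation in Liouville form: E² Δ log E = E ΔE − |∇E|². -/
theorem laplacian_log (h : ConformalOn X Ω) (hz : z ∈ Ω) :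
    pd 1 (pd 1 (fun y => Real.log (conformalFactor X y))) z
      + pd Complex.I (pd Complex.I (fun y => Real.log (conformalFactor X y))) z
      = -2 * gaussCurvature X z * conformalFactor X z := by
  have hp := (h.pos z hz).ne'
  have hE := h.smooth_conformalFactor
  have hl := hE.log fun z hz => (h.pos z hz).ne'
  have key : ∀ v, conformalFactor X z ^ 2 * pd v (pd v (fun y => Real.log (conformalFactor X y))) z
      = pd v (pd v (conformalFactor X)) z * conformalFactor X z - pd v (conformalFactor X) z ^ 2 := by
    intro v
    have e : ∀ y ∈ Ω, pd v (conformalFactor X) y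
        = conformalFactor X y * pd v (fun y => Real.log (conformalFactor X y)) y := by
      intro y hy
      have := (h.pos y hy).ne'
      rw [pd_log (h.diff_conformalFactor hy) this]
      field_simp
    rw [pd_congr h.isOpen e v hz, pd_mul (h.diff_conformalFactor hz)
      (differentiableAt_of_mem h.isOpen (hl.pd h.isOpen v) hz),
      pd_log (h.diff_conformalFactor hz) hp]
    field_simp
    ring
  have hg := h.gauss hz
  have h1 := key 1
  have h2 := key Complex.I
  apply mul_left_cancel₀ (pow_ne_zero 2 hp)
  rw [mul_add, h1, h2]
  linarith

/-- If `K I` is the same for two conformally parametrized surfaces, the logarithm of the ratio of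
their metrics is harmonic. -/
theorem harmonic_log_ratio (hX : ConformalOn X Ω) (hY : ConformalOn Y Ω)
    (hK : ∀ z ∈ Ω, gaussCurvature Y z * conformalFactor Y z
      = gaussCurvature X z * conformalFactor X z) :
    InnerProductSpace.HarmonicOnNhd
      (fun z => Real.log (conformalFactor Y z) - Real.log (conformalFactor X z)) Ω := by
  have ho := hX.isOpen
  have sX := hX.smooth_conformalFactor.log fun z hz => (hX.pos z hz).ne'
  have sY := hY.smooth_conformalFactor.log fun z hz => (hY.pos z hz).ne'
  refine harmonicOnNhd_of_pd ho (sY.sub sX) fun z hz => ?_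
  have key : ∀ v, pd v (pd v fun z => Real.log (conformalFactor Y z) - Real.log (conformalFactor X z)) z
      = pd v (pd v fun z => Real.log (conformalFactor Y z)) z
        - pd v (pd v fun z => Real.log (conformalFactor X z)) z := by
    intro v
    rw [pd_congr ho (fun y hy => pd_sub (differentiableAt_of_mem ho sY hy)
      (differentiableAt_of_mem ho sX hy) v) v hz]
    exact pd_sub (differentiableAt_of_mem ho (sY.pd ho v) hz)
      (differentiableAt_of_mem ho (sX.pd ho v) hz) v
  have h1 := hX.laplacian_log hz
  have h2 := hY.laplacian_log hz
  have h3 := hK z hz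
  rw [key, key]
  linarith

end ConformalOn

/-! ### Holomorphic functions with prescribed real part. -/

section Manifold

variable {M : Type*} [TopologicalSpace M] [ChartedSpace ℂ M]

/-- A holomorphic function of a coordinate is holomorphic on the surface. -/
theorem mdifferentiableAt_comp_chart [IsManifold 𝓘(ℂ) ω M] {p q : M} {g : ℂ → ℂ}
    (hq : q ∈ (chartAt ℂ p).source) (hg : DifferentiableAt ℂ g (chartAt ℂ p q)) :
    MDifferentiableAt 𝓘(ℂ) 𝓘(ℂ) (fun y => g (chartAt ℂ p y)) q := by
  have h1 : MDifferentiableAt 𝓘(ℂ) 𝓘(ℂ) (chartAt ℂ p) q :=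
    mdifferentiableAt_of_mem_maximalAtlas
      (IsManifold.maximalAtlas_subset_of_le (by simp) (chart_mem p)) hq
  exact hg.mdifferentiableAt.comp q h1

theorem MDifferentiableAt.comp_symm {e : OpenPartialHomeomorph M ℂ} (he : e ∈ complexCoords M)
    {f : M → ℂ} {z : ℂ} (hz : z ∈ e.target) (hf : MDifferentiableAt 𝓘(ℂ) 𝓘(ℂ) f (e.symm z)) :
    DifferentiableAt ℂ (f ∘ e.symm) z := by
  rw [← mdifferentiableAt_iff_differentiableAt]
  exact hf.comp z (mdifferentiableAt_symm_of_mem_maximalAtlas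
    (IsManifold.maximalAtlas_subset_of_le (by simp) he) hz)

/-- The derivative of Re D in the direction v is Re(v D'). Its vanishing for v = 1 and v = i kills
both parts of D'. -/
theorem deriv_eq_zero_of_re_eq_zero {D : ℂ → ℂ} {Ω : Set ℂ} (ho : IsOpen Ω)
    (hd : ∀ z ∈ Ω, DifferentiableAt ℂ D z) (hre : ∀ z ∈ Ω, (D z).re = 0) {z : ℂ} (hz : z ∈ Ω) :
    deriv D z = 0 := by
  have key : ∀ v, (v * deriv D z).re = 0 := by
    intro v
    have h1 := Complex.reCLM.hasFDerivAt.comp z ((hd z hz).restrictScalars ℝ).hasFDerivAt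
    have h2 : (Complex.reCLM ∘ D) =ᶠ[nhds z] fun _ => (0 : ℝ) := by
      filter_upwards [ho.mem_nhds hz] with y hy using hre y hy
    have h3 := congrArg (fun L : ℂ →L[ℝ] ℝ => L v) h1.fderiv
    rw [h2.fderiv_eq] at h3
    have h4 : fderiv ℝ D z v = v * deriv D z := pd_holomorphic (hd z hz) v
    simp [h4] at h3
    simpa using h3.symm
  apply Complex.ext
  · simpa using key 1
  · simpa using key Complex.I

theorem eventually_eq_of_re_eq_zero [IsManifold 𝓘(ℂ) ω M] {f : M → ℂ} {W : Set M} (hW : IsOpen W)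
    (hf : ∀ p ∈ W, MDifferentiableAt 𝓘(ℂ) 𝓘(ℂ) f p) (hre : ∀ p ∈ W, (f p).re = 0) {p : M}
    (hp : p ∈ W) : ∀ᶠ q in nhds p, f q = f p := by
  have ho : IsOpen ((chartAt ℂ p).target ∩ (chartAt ℂ p).symm ⁻¹' W) :=
    (chartAt ℂ p).symm.isOpen_inter_preimage hW
  have hmem : chartAt ℂ p p ∈ (chartAt ℂ p).target ∩ (chartAt ℂ p).symm ⁻¹' W :=
    ⟨mem_chart_target ℂ p, by simpa using hp⟩
  obtain ⟨ε, hε, hb⟩ := Metric.isOpen_iff.1 ho _ hmem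
  have hd : ∀ z ∈ (chartAt ℂ p).target ∩ (chartAt ℂ p).symm ⁻¹' W,
      DifferentiableAt ℂ (f ∘ (chartAt ℂ p).symm) z := fun z hz =>
    (hf _ hz.2).comp_symm (chart_mem p) hz.1
  have hc : ∀ z ∈ Metric.ball (chartAt ℂ p p) ε,
      (f ∘ (chartAt ℂ p).symm) z = (f ∘ (chartAt ℂ p).symm) (chartAt ℂ p p) := fun z hz =>
    Metric.isOpen_ball.is_const_of_deriv_eq_zero (convex_ball _ _).isPreconnected
      (fun y hy => (hd y (hb hy)).differentiableWithinAt)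
      (fun y hy => deriv_eq_zero_of_re_eq_zero ho hd (fun z hz => hre _ hz.2) (hb hy)) hz
      (Metric.mem_ball_self hε)
  have hcont := (chartAt ℂ p).continuousAt (mem_chart_source ℂ p)
  filter_upwards [(chartAt ℂ p).open_source.mem_nhds (mem_chart_source ℂ p),
    hcont (Metric.ball_mem_nhds _ hε)] with y hy hy'
  have := hc _ hy'
  simp only [Function.comp_apply] at this
  rwa [(chartAt ℂ p).left_inv hy, (chartAt ℂ p).left_inv (mem_chart_source ℂ p)] at this

/-- A function which is harmonic in local coordinates is, on a simply connected open set, the real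
part of a holomorphic function. -/
theorem exists_holomorphic_re_eq [IsManifold 𝓘(ℂ) ω M] {u : M → ℝ}
    (hu : ∀ p : M, InnerProductSpace.HarmonicOnNhd (u ∘ (chartAt ℂ p).symm) (chartAt ℂ p).target)
    {U : Set M} (hU : IsOpen U) (hs : SimplyConnectedSpace U) :
    ∃ f : M → ℂ, MDifferentiableOn 𝓘(ℂ) 𝓘(ℂ) f U ∧ ∀ p ∈ U, (f p).re = u p := by
  have hball : ∀ p : M, ∃ R > 0, Metric.ball (chartAt ℂ p p) R ⊆ (chartAt ℂ p).target := fun p =>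
    Metric.mem_nhds_iff.1 ((chartAt ℂ p).open_target.mem_nhds (mem_chart_target ℂ p))
  choose R hR hsub using hball
  have hg : ∀ p : M, ∃ g : ℂ → ℂ, AnalyticOnNhd ℂ g (Metric.ball (chartAt ℂ p p) (R p)) ∧
      (Metric.ball (chartAt ℂ p p) (R p)).EqOn (fun z => (g z).re) (u ∘ (chartAt ℂ p).symm) :=
    fun p => ((hu p).mono (hsub p)).exists_analyticOnNhd_ball_re_eq
  choose g hga hgr using hg
  let N : M → Set M := fun p => (chartAt ℂ p).source ∩ chartAt ℂ p ⁻¹' Metric.ball (chartAt ℂ p p) (R p)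
  have hN : ∀ p, IsOpen (N p) := fun p =>
    (chartAt ℂ p).isOpen_inter_preimage Metric.isOpen_ball
  have hpN : ∀ p, p ∈ N p := fun p => ⟨mem_chart_source ℂ p, Metric.mem_ball_self (hR p)⟩
  let G : M → M → ℂ := fun p q => g p (chartAt ℂ p q)
  have hGre : ∀ p, ∀ q ∈ N p, (G p q).re = u q := by
    intro p q hq
    have := hgr p hq.2
    simp only [Function.comp_apply] at this
    rw [(chartAt ℂ p).left_inv hq.1] at this
    exact this
  have hGd : ∀ p, ∀ q ∈ N p, MDifferentiableAt 𝓘(ℂ) 𝓘(ℂ) (G p) q := fun p q hq =>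
    mdifferentiableAt_comp_chart hq.1 (hga p _ hq.2).differentiableAt
  -- Two local solutions have the same real part u, so their difference is holomorphic and purely
  -- imaginary, hence locally constant. Only imaginary parts need gluing.
  have hloc : ∀ p q, ∀ x ∈ N p ∩ N q, ∀ᶠ y in nhds x,
      (G p y).im - (G q y).im = (G p x).im - (G q x).im := by
    intro p q x hx
    have := eventually_eq_of_re_eq_zero (f := fun y => G p y - G q y) ((hN p).inter (hN q))
      (fun y hy => (hGd p y hy.1).sub (hGd q y hy.2))
      (fun y hy => by rw [Complex.sub_re, hGre p y hy.1, hGre q y hy.2, sub_self]) hx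
    filter_upwards [this] with y hy
    rw [← Complex.sub_im, ← Complex.sub_im, hy]
  have : LocallyPathConnectedSpace M := ChartedSpace.locallyPathConnectedSpace ℂ M
  have : LocallyPathConnectedSpace U := hU.locallyPathConnectedSpace
  obtain ⟨H, hH⟩ := exists_global_of_locally_const_sub (X := U) (ι := U)
    (fun p => Subtype.val ⁻¹' N p) (fun p => (hN p).preimage continuous_subtype_val)
    id (fun p => hpN p) (fun p q => (G p q).im) (fun p q x hx =>
      (continuous_subtype_val.tendsto x).eventually (hloc p q x hx))
  classical
  -- The value of the imaginary part outside U is irrelevant: near each point of the open set U, f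
  -- differs from a local solution by an imaginary constant.
  let f : M → ℂ := fun p => ⟨u p, if hp : p ∈ U then H ⟨p, hp⟩ else 0⟩
  refine ⟨f, fun p hp => MDifferentiableAt.mdifferentiableWithinAt ?_, fun p _ => rfl⟩
  have h1 := hH ⟨p, hp⟩
  rw [nhds_subtype_eq_comap, Filter.eventually_comap] at h1
  have hev : f =ᶠ[nhds p] fun q => G p q + ((H ⟨p, hp⟩ - (G p p).im : ℝ) : ℂ) * Complex.I := by
    filter_upwards [h1, hU.mem_nhds hp, (hN p).mem_nhds (hpN p)] with q hq hqU hqN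
    have h2 := hq ⟨q, hqU⟩ rfl
    simp only [id] at h2
    apply Complex.ext
    · simp [f, hGre p q hqN]
    · simp only [f, dif_pos hqU, Complex.add_im, Complex.mul_im, Complex.ofReal_re,
        Complex.ofReal_im, Complex.I_re, Complex.I_im]
      linarith
  exact ((hGd p p (hpN p)).add mdifferentiableAt_const).congr_of_eventuallyEq hev

end Manifold

/-! ### Codazzi equations under a holomorphic factor. -/

/-- A nonvanishing holomorphic function is locally the inverse of a square. -/
theorem exists_local_inv_sqrt {f : ℂ → ℂ} {Ω : Set ℂ} (ho : IsOpen Ω)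
    (hf : ∀ z ∈ Ω, DifferentiableAt ℂ f z) {z₀ : ℂ} (hz : z₀ ∈ Ω) (h0 : f z₀ ≠ 0) :
    ∃ (w : ℂ → ℂ) (ε : ℝ), 0 < ε ∧ Metric.ball z₀ ε ⊆ Ω ∧
      ∀ z ∈ Metric.ball z₀ ε, DifferentiableAt ℂ w z ∧ w z ^ 2 * f z = 1 := by
  obtain ⟨b, hb⟩ := IsAlgClosed.exists_pow_nat_eq (f z₀)⁻¹ (n := 2) (by norm_num)
  have hev : ∀ᶠ z in nhds z₀, f z / f z₀ ∈ Complex.slitPlane := by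
    have hc : ContinuousAt (fun z => f z / f z₀) z₀ := (hf z₀ hz).continuousAt.div_const _
    exact hc.eventually_mem (Complex.isOpen_slitPlane.mem_nhds (by
      rw [div_self h0]; exact Complex.one_mem_slitPlane))
  obtain ⟨ε, hε, hball⟩ := Metric.mem_nhds_iff.1 (hev.and (ho.mem_nhds hz))
  -- Near z₀ the quotient f/f(z₀) is close to 1, so the principal logarithm applies; b, a square
  -- root of 1/f(z₀), restores the normalization.
  refine ⟨fun z => b * Complex.exp (-(1 / 2) * Complex.log (f z / f z₀)), ε, hε,
    fun z hz => (hball hz).2, fun z hz => ⟨?_, ?_⟩⟩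
  · exact ((((hf z (hball hz).2).div_const _).clog (hball hz).1).const_mul _).cexp.const_mul _
  · have hne : f z / f z₀ ≠ 0 := Complex.slitPlane_ne_zero (hball hz).1
    have hfz : f z ≠ 0 := fun h => hne (by rw [h, zero_div])
    rw [mul_pow, hb, ← Complex.exp_nat_mul]
    have : ((2 : ℕ) : ℂ) * (-(1 / 2) * Complex.log (f z / f z₀))
        = -Complex.log (f z / f z₀) := by push_cast; ring
    rw [this, Complex.exp_neg, Complex.exp_log hne]
    field_simp

namespace ConformalOn

variable {X Y : ℂ → E3} {Ω : Set ℂ} {z : ℂ}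

/-- If the Hopf differential is multiplied by a holomorphic function, with the corresponding change
of the metric and of the mean curvature, the Codazzi equations determine the mean curvature. -/
theorem fderiv_meanCurvature_mul_im {f w : ℂ → ℂ} (hX : ConformalOn X Ω) (hY : ConformalOn Y Ω)
    (hf : ∀ z ∈ Ω, DifferentiableAt ℂ f z) (hw : ∀ z ∈ Ω, DifferentiableAt ℂ w z)
    (hwf : ∀ z ∈ Ω, w z ^ 2 * f z = 1)
    (hE : ∀ z ∈ Ω, conformalFactor Y z = ‖f z‖ ^ 2 * conformalFactor X z)
    (hH : ∀ z ∈ Ω, meanCurvature Y z = 1 / ‖f z‖ * meanCurvature X z)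
    (hQ : ∀ z ∈ Ω, hopfCoeff Y z = f z * hopfCoeff X z) (hz : z ∈ Ω) :
    DifferentiableAt ℝ (fun y => meanCurvature X y * (w y).im) z ∧
      fderiv ℝ (fun y => meanCurvature X y * (w y).im) z = 0 := by
  have ho := hX.isOpen
  have dH := differentiableAt_of_mem ho hX.smooth_meanCurvature hz
  have dH' := differentiableAt_of_mem ho hY.smooth_meanCurvature hz
  have dHc : DifferentiableAt ℝ (fun y => (meanCurvature X y : ℂ)) z :=
    Complex.ofRealCLM.differentiableAt.comp z dH
  have dQ := differentiableAt_of_mem ho hX.smooth_hopfCoeff hz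
  have df : DifferentiableAt ℝ f z := (hf z hz).restrictScalars ℝ
  have dw : DifferentiableAt ℝ w z := (hw z hz).restrictScalars ℝ
  have dwc : DifferentiableAt ℝ (fun y => (starRingEnd ℂ) (w y)) z :=
    Complex.conjCLE.differentiableAt.comp z dw
  have dwi : DifferentiableAt ℝ (fun y => (w y).im) z :=
    Complex.imCLM.differentiableAt.comp z dw
  have hf0 : f z ≠ 0 := right_ne_zero_of_mul_eq_one (hwf z hz)
  have hw0 : w z ≠ 0 := by
    have := left_ne_zero_of_mul_eq_one (hwf z hz)
    exact fun h => this (by rw [h]; simp)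
  have hp : (conformalFactor X z : ℂ) ≠ 0 := Complex.ofReal_ne_zero.2 (hX.pos z hz).ne'
  have eQ : ∀ v, pd v (hopfCoeff Y) z = v * deriv f z * hopfCoeff X z + f z * pd v (hopfCoeff X) z := by
    intro v
    rw [pd_congr ho hQ v hz, pd_mul df dQ, pd_holomorphic (hf z hz)]
  have hH' : ∀ y ∈ Ω, (meanCurvature Y y : ℂ)
      = meanCurvature X y * (w y * (starRingEnd ℂ) (w y)) := by
    intro y hy
    rw [hH y hy, Complex.mul_conj, Complex.normSq_eq_norm_sq]
    have h1 : ‖w y‖ ^ 2 * ‖f y‖ = 1 := by rw [← norm_pow, ← norm_mul, hwf y hy, norm_one]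
    have h2 : 1 / ‖f y‖ = ‖w y‖ ^ 2 := by
      rw [div_eq_iff (right_ne_zero_of_mul_eq_one h1), h1]
    rw [h2]
    push_cast
    ring
  have eH : ∀ v, ((pd v (meanCurvature Y) z : ℝ) : ℂ)
      = (pd v (meanCurvature X) z : ℝ) * (w z * (starRingEnd ℂ) (w z))
        + meanCurvature X z * (v * deriv w z * (starRingEnd ℂ) (w z)
          + w z * (starRingEnd ℂ) (v * deriv w z)) := by
    intro v
    rw [← pd_ofReal dH', pd_congr ho hH' v hz, pd_mul dHc (dw.fun_mul dwc), pd_ofReal dH,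
      pd_mul dw dwc, pd_conj dw, pd_holomorphic (hw z hz)]
  have c1 := hX.codazzi hz
  have c2 := hY.codazzi hz
  rw [eQ, eQ, hE z hz, eH, eH] at c2
  have hI : I * I = -1 := Complex.I_mul_I
  have hnorm : ((‖f z‖ : ℝ) : ℂ) ^ 2 = f z * (starRingEnd ℂ) (f z) := by
    rw [Complex.mul_conj, Complex.normSq_eq_norm_sq]; push_cast; rfl
  have hwfc : (starRingEnd ℂ) (w z) ^ 2 * (starRingEnd ℂ) (f z) = 1 := by
    rw [← map_pow, ← map_mul, hwf z hz, map_one]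
  have hwc0 : (starRingEnd ℂ) (w z) ≠ 0 := by simpa using hw0
  set wc := (starRingEnd ℂ) (w z) with hwc
  -- D is 2 ∂_z H.
  set D : ℂ := (pd 1 (meanCurvature X) z : ℝ) - I * (pd I (meanCurvature X) z : ℝ) with hD
  have e1 : f z * (conformalFactor X z / 2) * D
      = f z * (starRingEnd ℂ) (f z) * (conformalFactor X z / 2)
        * (D * (w z * wc) + meanCurvature X z * (2 * deriv w z * wc)) := by
    -- This is the Codazzi equation of Y. The multiples of I² + 1 remove ∂_z̄ f and ∂_z w̄, which
    -- vanish because f and w are holomorphic.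
    have hs : f z * (pd 1 (hopfCoeff X) z + I * pd I (hopfCoeff X) z)
        = f z * (starRingEnd ℂ) (f z) * (conformalFactor X z / 2)
        * (D * (w z * wc) + meanCurvature X z * (2 * deriv w z * wc)) := by
      rw [← hnorm]
      push_cast at c2
      simp only [map_mul, map_one, Complex.conj_I] at c2
      linear_combination c2 - deriv f z * hopfCoeff X z * hI
        - ((‖f z‖ : ℝ) : ℂ) ^ 2 * (conformalFactor X z / 2) * meanCurvature X z
          * (deriv w z * wc - w z * (starRingEnd ℂ) (deriv w z)) * hI
    rw [← hs, c1]
    push_cast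
    ring
  have e2 : D = (starRingEnd ℂ) (f z)
      * (D * (w z * wc) + meanCurvature X z * (2 * deriv w z * wc)) := by
    have : f z * (conformalFactor X z / 2 : ℂ) ≠ 0 := mul_ne_zero hf0 (div_ne_zero hp two_ne_zero)
    apply mul_left_cancel₀ this
    linear_combination e1
  -- Multiplication by w̄² and w̄² f̄ = 1 reduce the equation to ∂_z(H(w − w̄)) = 0.
  have e3 : wc * D = w z * D + 2 * meanCurvature X z * deriv w z := by
    apply mul_left_cancel₀ hwc0
    linear_combination wc ^ 2 * e2
      + (D * (w z * wc) + meanCurvature X z * (2 * deriv w z * wc)) * hwfc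
  have him : ((w z).im : ℂ) = (w z - wc) / (2 * I) := by
    rw [hwc, Complex.sub_conj]
    push_cast
    field_simp
  have eP : ∀ v, pd v (fun y => meanCurvature X y * (w y).im) z
      = pd v (meanCurvature X) z * (w z).im + meanCurvature X z * (v * deriv w z).im := by
    intro v
    have h1 : pd v (fun y => (w y).im) z = (v * deriv w z).im := by
      have := (Complex.imCLM.hasFDerivAt (x := w z)).comp z dw.hasFDerivAt
      rw [pd, show (fun y => (w y).im) = Complex.imCLM ∘ w from rfl, this.fderiv,
        ← pd_holomorphic (hw z hz)]
      rfl
    rw [pd_mul dH dwi, h1]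
  have eP' : ((pd 1 (fun y => meanCurvature X y * (w y).im) z : ℝ) : ℂ)
      - I * (pd I (fun y => meanCurvature X y * (w y).im) z : ℝ) = 0 := by
    have h1 : ((1 * deriv w z).im : ℂ) - I * ((I * deriv w z).im : ℂ) = -I * deriv w z := by
      apply Complex.ext <;> simp
    have h2 : ((pd 1 (fun y => meanCurvature X y * (w y).im) z : ℝ) : ℂ)
        - I * (pd I (fun y => meanCurvature X y * (w y).im) z : ℝ)
        = D * ((w z).im : ℂ) + meanCurvature X z * (-I * deriv w z) := by
      rw [eP, eP, ← h1, hD]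
      push_cast
      ring
    rw [h2, him]
    have hI0 : I ≠ 0 := Complex.I_ne_zero
    field_simp
    rw [Complex.I_sq]
    linear_combination -e3
  -- H Im w is real, so the vanishing of its ∂_z gives the vanishing of both real partial
  -- derivatives.
  have hre := congrArg Complex.re eP'
  have him' := congrArg Complex.im eP'
  simp at hre him'
  exact ⟨dH.mul dwi, fderiv_eq_zero_of_pd hre him'⟩

end ConformalOn

/-! ### Consequences of scaled data. -/

section Manifold

variable {M : Type*} [TopologicalSpace M] [ChartedSpace ℂ M]

/-- The data of `G` arise from those of `F` by the factor `l`. -/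
structure ScaledData (F G : M → E3) (l : M → ℂ) : Prop where
  left : ∀ e ∈ complexCoords M, ConformalOn (F ∘ e.symm) e.target
  right : ∀ e ∈ complexCoords M, ConformalOn (G ∘ e.symm) e.target
  ne_zero : ∀ p, l p ≠ 0
  factor : ∀ e ∈ complexCoords M, ∀ z ∈ e.target,
    conformalFactor (G ∘ e.symm) z = ‖l (e.symm z)‖ ^ 2 * conformalFactor (F ∘ e.symm) z
  mean : ∀ e ∈ complexCoords M, ∀ z ∈ e.target,
    meanCurvature (G ∘ e.symm) z = 1 / ‖l (e.symm z)‖ * meanCurvature (F ∘ e.symm) z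
  hopf : ∀ e ∈ complexCoords M, ∀ z ∈ e.target,
    hopfCoeff (G ∘ e.symm) z = l (e.symm z) * hopfCoeff (F ∘ e.symm) z

namespace ScaledData

variable {F G : M → E3} {l : M → ℂ}

/-- From K = H² − 4|Q|²/E², scaling divides K by |l|² while E is multiplied by |l|². So KE is
preserved, and log|l|, half the logarithm of the ratio of the metrics, is harmonic. Exponentiate a
holomorphic function with this real part. -/
theorem exists_holomorphic_norm_eq [IsManifold 𝓘(ℂ) ω M] (h : ScaledData F G l)
    {U : Set M} (hU : IsOpen U) (hs : SimplyConnectedSpace U) :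
    ∃ f : M → ℂ, MDifferentiableOn 𝓘(ℂ) 𝓘(ℂ) f U ∧ ∀ p ∈ U, ‖l p‖ = ‖f p‖ := by
  have hh : ∀ p : M, InnerProductSpace.HarmonicOnNhd
      ((fun q => Real.log ‖l q‖) ∘ (chartAt ℂ p).symm) (chartAt ℂ p).target := by
    intro p z hz
    have he := chart_mem p
    have hX := h.left _ he
    have hY := h.right _ he
    have h1 := (ConformalOn.harmonic_log_ratio hX hY fun y hy => by
      have hp := (hX.pos y hy).ne'
      have hl := norm_ne_zero_iff.2 (h.ne_zero ((chartAt ℂ p).symm y))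
      have kX := hX.sq_sub_gauss hy
      have kY := hY.sq_sub_gauss hy
      rw [h.factor _ he y hy, h.mean _ he y hy, h.hopf _ he y hy, norm_mul] at kY
      have gX : gaussCurvature (F ∘ (chartAt ℂ p).symm) y
          = meanCurvature (F ∘ (chartAt ℂ p).symm) y ^ 2
            - 4 * ‖hopfCoeff (F ∘ (chartAt ℂ p).symm) y‖ ^ 2
              / conformalFactor (F ∘ (chartAt ℂ p).symm) y ^ 2 := by linarith
      have gY := eq_sub_of_add_eq' (sub_eq_iff_eq_add.1 kY).symm
      rw [h.factor _ he y hy, gX, gY]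
      field_simp) z hz
    have h2 := h1.const_smul (c := (1 / 2 : ℝ))
    refine (InnerProductSpace.harmonicAt_congr_nhds ?_).1 h2
    filter_upwards [(chartAt ℂ p).open_target.mem_nhds hz] with y hy
    have hp := (hX.pos y hy).ne'
    have hl := norm_ne_zero_iff.2 (h.ne_zero ((chartAt ℂ p).symm y))
    simp only [Pi.smul_apply, Function.comp_apply, smul_eq_mul]
    rw [h.factor _ he y hy, Real.log_mul (pow_ne_zero 2 hl) hp, Real.log_pow]
    push_cast
    ring
  obtain ⟨g, hg, hre⟩ := exists_holomorphic_re_eq hh hU hs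
  refine ⟨fun p => Complex.exp (g p), ?_, fun p hp => ?_⟩
  · intro p hp
    exact Complex.differentiable_exp.mdifferentiable.mdifferentiableAt.comp_mdifferentiableWithinAt
      p (hg p hp)
  · rw [Complex.norm_exp, hre p hp, Real.exp_log (norm_pos_iff.2 (h.ne_zero p))]

/-- For a constant factor r > 0 the scaled surface rF has exactly the data of G, so the two are
congruent. Positivity matters: a constant phase would change Q but not E or H. -/
theorem similar [ConnectedSpace M] [IsManifold 𝓘(ℂ) ω M] (h : ScaledData F G l) {r : ℝ}
    (hr : 0 < r) (hl : ∀ p, l p = r) : SimilarSurfaces F G := by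
  have hn : ∀ p, ‖l p‖ = r := fun p => by rw [hl]; simp [abs_of_pos hr]
  obtain ⟨A, b, hAb⟩ := congruent_of_data (F := fun p => r • F p) (G := G)
    (fun e he => (h.left e he).smul hr.ne') h.right (fun e he z hz => by
      have hX := h.left e he
      refine ⟨?_, ?_, ?_⟩
      · rw [h.factor e he z hz, hn]
        exact (ConformalOn.conformalFactor_smul _ r z).symm
      · rw [h.mean e he z hz, hn]
        exact (hX.meanCurvature_smul hr.ne' hz).symm
      · rw [h.hopf e he z hz, hl]
        exact (hX.hopfCoeff_smul hr.ne' hz).symm)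
  exact ⟨r, A, b, hr, fun p => by rw [hAb p, map_smul]⟩

end ScaledData

/-- With a⁻¹ = w², this is |w|² − Re w² = 2(Im w)². The left side does not depend on the branch w,
so the local constants H Im w yield a global one up to sign. -/
theorem sq_mul_norm_inv_sub_re {w a : ℂ} (h : w ^ 2 * a = 1) (H : ℝ) :
    H ^ 2 * (‖a⁻¹‖ - (a⁻¹).re) = 2 * (H * w.im) ^ 2 := by
  have ha : a⁻¹ = w ^ 2 := by
    have := right_ne_zero_of_mul_eq_one h
    field_simp
    linear_combination -h
  rw [ha, norm_pow, ← Complex.normSq_eq_norm_sq, Complex.normSq_apply]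
  simp [sq]
  ring

/-- The identity theorem: a holomorphic function on a connected Riemann surface that is constant
near a point is constant. -/
theorem eq_const_of_eventually_eq [ConnectedSpace M] [IsManifold 𝓘(ℂ) ω M] {l : M → ℂ}
    (hl : MDifferentiable 𝓘(ℂ) 𝓘(ℂ) l) {c : ℂ} {p₀ : M} (h0 : ∀ᶠ q in nhds p₀, l q = c) (p : M) :
    l p = c := by
  let S : Set M := {p | ∀ᶠ q in nhds p, l q = c}
  have hopen : IsOpen S := by
    rw [isOpen_iff_mem_nhds]
    intro p hp
    exact eventually_eventually_nhds.2 hp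
  have hclosed : IsClosed S := by
    rw [← closure_subset_iff_isClosed]
    intro p hp
    have he := chart_mem p
    obtain ⟨ε, hε, hb⟩ := Metric.isOpen_iff.1 (chartAt ℂ p).open_target _ (mem_chart_target ℂ p)
    let N : Set M := (chartAt ℂ p).source ∩ chartAt ℂ p ⁻¹' Metric.ball (chartAt ℂ p p) ε
    have hN : IsOpen N := (chartAt ℂ p).isOpen_inter_preimage Metric.isOpen_ball
    have hpN : p ∈ N := ⟨mem_chart_source ℂ p, Metric.mem_ball_self hε⟩
    obtain ⟨q, hqN, hqS⟩ := mem_closure_iff.1 hp N hN hpN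
    have han : AnalyticOnNhd ℂ (l ∘ (chartAt ℂ p).symm) (Metric.ball (chartAt ℂ p p) ε) :=
      DifferentiableOn.analyticOnNhd (fun z hz =>
        ((hl _).comp_symm he (hb hz)).differentiableWithinAt) Metric.isOpen_ball
    have hcont : ContinuousAt (chartAt ℂ p).symm (chartAt ℂ p q) :=
      (chartAt ℂ p).symm.continuousAt (hb hqN.2)
    have hev : l ∘ (chartAt ℂ p).symm =ᶠ[nhds (chartAt ℂ p q)] fun _ => c := by
      rw [ContinuousAt, (chartAt ℂ p).left_inv hqN.1] at hcont
      exact hcont.eventually hqS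
    have heq := han.eqOn_of_preconnected_of_eventuallyEq analyticOnNhd_const
      (convex_ball _ _).isPreconnected hqN.2 hev
    filter_upwards [hN.mem_nhds hpN] with y hy
    have := heq hy.2
    simp only [Function.comp_apply] at this
    rwa [(chartAt ℂ p).left_inv hy.1] at this
  have huniv : S = Set.univ := IsClopen.eq_univ ⟨hclosed, hopen⟩ ⟨p₀, h0⟩
  have hp : p ∈ S := huniv ▸ Set.mem_univ p
  exact Filter.Eventually.self_of_nhds (p := fun q => l q = c) hp

namespace ScaledData

variable {F G : M → E3} {l : M → ℂ}

/-- Near each point, `H` times the imaginary part of a branch of `1 / √l` is constant. -/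
theorem exists_local_const (h : ScaledData F G l) (hl : MDifferentiable 𝓘(ℂ) 𝓘(ℂ) l)
    [IsManifold 𝓘(ℂ) ω M] {e : OpenPartialHomeomorph M ℂ} (he : e ∈ complexCoords M) {z₀ : ℂ}
    (hz₀ : z₀ ∈ e.target) : ∃ (w : ℂ → ℂ) (ε : ℝ) (k : ℝ), 0 < ε ∧ Metric.ball z₀ ε ⊆ e.target ∧
      ∀ z ∈ Metric.ball z₀ ε, DifferentiableAt ℂ w z ∧ w z ^ 2 * l (e.symm z) = 1 ∧
        meanCurvature (F ∘ e.symm) z * (w z).im = k := by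
  have hd : ∀ z ∈ e.target, DifferentiableAt ℂ (l ∘ e.symm) z := fun z hz => (hl _).comp_symm he hz
  obtain ⟨w, ε, hε, hb, hw⟩ := exists_local_inv_sqrt e.open_target hd hz₀ (h.ne_zero _)
  have key := fun z hz => ConformalOn.fderiv_meanCurvature_mul_im (z := z)
    ((h.left e he).mono Metric.isOpen_ball hb) ((h.right e he).mono Metric.isOpen_ball hb)
    (fun z hz => hd z (hb hz)) (fun z hz => (hw z hz).1) (fun z hz => (hw z hz).2)
    (fun z hz => h.factor e he z (hb hz)) (fun z hz => h.mean e he z (hb hz))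
    (fun z hz => h.hopf e he z (hb hz)) hz
  refine ⟨w, ε, meanCurvature (F ∘ e.symm) z₀ * (w z₀).im, hε, hb, fun z hz =>
    ⟨(hw z hz).1, (hw z hz).2, ?_⟩⟩
  exact Metric.isOpen_ball.is_const_of_fderiv_eq_zero (convex_ball _ _).isPreconnected
    (fun y hy => (key y hy).1.differentiableWithinAt) (fun y hy => (key y hy).2) hz
    (Metric.mem_ball_self hε)

theorem isHIMCSurface [ConnectedSpace M] [IsManifold 𝓘(ℂ) ω M] (h : ScaledData F G l)
    (hl : MDifferentiable 𝓘(ℂ) 𝓘(ℂ) l) (hmin : ¬ IsMinimalSurface F)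
    (hsim : ¬ SimilarSurfaces F G) : IsHIMCSurface F := by
  let Hc : M → ℝ := fun p => meanCurvature (F ∘ (chartAt ℂ p).symm) (chartAt ℂ p p)
  have hHc : ∀ e ∈ complexCoords M, ∀ z ∈ e.target,
      Hc (e.symm z) = meanCurvature (F ∘ e.symm) z := by
    intro e he z hz
    obtain ⟨h1, h2, h3, h4⟩ := transition_spec he (chart_mem (e.symm z))
    exact (ConformalOn.meanCurvature_comp ((h.left e he).mono h1 Set.inter_subset_left)
      (h.left _ (chart_mem _)) h2 h3 (h4 F) ⟨hz, mem_chart_source ℂ _⟩).symm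
  let g : M → ℝ := fun p => Hc p ^ 2 * (‖(l p)⁻¹‖ - ((l p)⁻¹).re)
  have hgc : ∀ p q, g p = g q := eq_of_fderiv_eq_zero fun p => by
    obtain ⟨w, ε, k, hε, hb, hw⟩ := h.exists_local_const hl (chart_mem p) (mem_chart_target ℂ p)
    refine ⟨_, Metric.ball_mem_nhds _ hε, fun z hz => ?_⟩
    have hev : g ∘ (chartAt ℂ p).symm =ᶠ[nhds z] fun _ => 2 * k ^ 2 := by
      filter_upwards [Metric.isOpen_ball.mem_nhds hz] with y hy
      simp only [g, Function.comp_apply]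
      rw [hHc _ (chart_mem p) y (hb hy), sq_mul_norm_inv_sub_re (hw y hy).2.1, (hw y hy).2.2]
    rw [hev.differentiableAt_iff, hev.fderiv_eq]
    simp
  -- g is a constant 2k². The value 0 leads to a similarity; any other value forces H ≠ 0 everywhere
  -- and 1/H = (Im w)/k.
  by_cases hzero : ∀ p, g p = 0
  · exfalso
    obtain ⟨e, he, z, hz, hne⟩ : ∃ e ∈ complexCoords M, ∃ z ∈ e.target,
        meanCurvature (F ∘ e.symm) z ≠ 0 := by
      by_contra! hcon
      exact hmin hcon
    have hreal : ∀ᶠ y in nhds z, ‖(l (e.symm y))⁻¹‖ = ((l (e.symm y))⁻¹).re := by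
      have hcont : ContinuousAt (meanCurvature (F ∘ e.symm)) z :=
        (differentiableAt_of_mem e.open_target (h.left e he).smooth_meanCurvature hz).continuousAt
      filter_upwards [hcont.eventually_ne hne, e.open_target.mem_nhds hz] with y hy hyt
      have := hzero (e.symm y)
      simp only [g, hHc e he y hyt] at this
      exact sub_eq_zero.1 ((mul_eq_zero.1 this).resolve_left (pow_ne_zero 2 hy))
    have hreal' : ∀ᶠ q in nhds (e.symm z), ‖(l q)⁻¹‖ = ((l q)⁻¹).re := by
      have hcont := e.continuousAt (e.map_target hz)
      rw [ContinuousAt, e.right_inv hz] at hcont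
      filter_upwards [hcont.eventually hreal, e.open_source.mem_nhds (e.map_target hz)] with q hq hqs
      rwa [e.left_inv hqs] at hq
    obtain ⟨W, hWsub, hWo, hzW⟩ := mem_nhds_iff.1 hreal'
    have hinv : ∀ q ∈ W, ((l q)⁻¹) = (‖(l q)⁻¹‖ : ℂ) := by
      intro q hq
      have h1 : ‖(l q)⁻¹‖ = ((l q)⁻¹).re := hWsub hq
      have h2 : ((l q)⁻¹).re ^ 2 = ((l q)⁻¹).re ^ 2 + ((l q)⁻¹).im ^ 2 := by
        conv_lhs => rw [← h1, ← Complex.normSq_eq_norm_sq, Complex.normSq_apply]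
        ring
      apply Complex.ext
      · simp [← h1]
      · rw [Complex.ofReal_im]
        exact pow_eq_zero_iff two_ne_zero |>.1 (by linarith)
    -- l is real on W, so i l is holomorphic with zero real part and therefore locally constant.
    have hcst := eventually_eq_of_re_eq_zero (f := fun q => I * l q) hWo
      (fun q _ => mdifferentiableAt_const.mul (hl q)) (fun q hq => by
        have : l q = ((‖(l q)⁻¹‖⁻¹ : ℝ) : ℂ) := by
          rw [Complex.ofReal_inv, ← hinv q hq, inv_inv]
        rw [this]
        simp) hzW
    have hval : l (e.symm z) = ((‖(l (e.symm z))⁻¹‖⁻¹ : ℝ) : ℂ) := by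
      rw [Complex.ofReal_inv, ← hinv _ hzW, inv_inv]
    have hr : 0 < ‖(l (e.symm z))⁻¹‖⁻¹ :=
      inv_pos.2 (norm_pos_iff.2 (inv_ne_zero (h.ne_zero _)))
    refine hsim (h.similar hr (eq_const_of_eventually_eq hl (p₀ := e.symm z) ?_))
    filter_upwards [hcst] with q hq
    rw [← hval]
    exact mul_left_cancel₀ Complex.I_ne_zero hq
  · push Not at hzero
    obtain ⟨p₁, hp₁⟩ := hzero
    have hgne : ∀ p, g p ≠ 0 := fun p => by rw [hgc p p₁]; exact hp₁
    intro e he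
    have hne : ∀ z ∈ e.target, meanCurvature (F ∘ e.symm) z ≠ 0 := by
      intro z hz h0
      apply hgne (e.symm z)
      simp only [g]
      rw [hHc e he z hz, h0]
      simp
    refine ⟨hne, fun z hz => ?_⟩
    obtain ⟨w, ε, k, hε, hb, hw⟩ := h.exists_local_const hl he hz
    have hk : k ≠ 0 := by
      rintro rfl
      apply hgne (e.symm z)
      simp only [g]
      have hzb := hw z (Metric.mem_ball_self hε)
      rw [hHc e he z hz, sq_mul_norm_inv_sub_re hzb.2.1, hzb.2.2]
      simp
    have han : AnalyticAt ℂ w z :=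
      (DifferentiableOn.analyticOnNhd (fun y hy => (hw y hy).1.differentiableWithinAt)
        Metric.isOpen_ball) z (Metric.mem_ball_self hε)
    have hharm := han.harmonicAt_im.const_smul (c := k⁻¹)
    refine (InnerProductSpace.harmonicAt_congr_nhds ?_).1 hharm
    filter_upwards [Metric.ball_mem_nhds z hε] with y hy
    have h1 := (hw y hy).2.2
    have h2 := hne y (hb hy)
    simp only [Pi.smul_apply, smul_eq_mul]
    field_simp
    linarith

end ScaledData

end Manifold

/-! ### What the Möbius metric and the curvature ratio determine. -/

namespace ConformalOn

variable {X Y : ℂ → E3} {Ω : Set ℂ} {z : ℂ}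

theorem hopfCoeff_ne_zero (hX : ConformalOn X Ω) (hz : z ∈ Ω)
    (hU : meanCurvature X z ^ 2 - gaussCurvature X z ≠ 0) : hopfCoeff X z ≠ 0 := by
  intro h0
  rw [hX.sq_sub_gauss hz, h0] at hU
  simp at hU

theorem sq_sub_gauss_pos (hX : ConformalOn X Ω) (hz : z ∈ Ω)
    (hU : meanCurvature X z ^ 2 - gaussCurvature X z ≠ 0) :
    0 < meanCurvature X z ^ 2 - gaussCurvature X z := by
  refine lt_of_le_of_ne ?_ hU.symm
  rw [hX.sq_sub_gauss hz]
  positivity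

/-- A surface with the Möbius metric of an umbilic-free conformally parametrized surface is
conformally parametrized. -/
theorem of_moebiusMetric (hX : ConformalOn X Ω)
    (hU : ∀ z ∈ Ω, meanCurvature X z ^ 2 - gaussCurvature X z ≠ 0) (hY : ContDiffOn ℝ ∞ Y Ω)
    (hM : ∀ z ∈ Ω, ∀ v w, moebiusMetric Y z v w = moebiusMetric X z v w) : ConformalOn Y Ω := by
  have h11 : ∀ z ∈ Ω, 0 < (meanCurvature Y z ^ 2 - gaussCurvature Y z) * firstForm Y z 1 1 := by
    intro z hz
    have := hM z hz 1 1
    rw [moebiusMetric] at this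
    rw [this]
    exact mul_pos (hX.sq_sub_gauss_pos hz (hU z hz)) (hX.pos z hz)
  have hne : ∀ z ∈ Ω, meanCurvature Y z ^ 2 - gaussCurvature Y z ≠ 0 := fun z hz =>
    left_ne_zero_of_mul (h11 z hz).ne'
  refine ⟨hX.isOpen, hY, fun z hz => ?_, fun z hz => ?_, fun z hz => ?_⟩
  · exact lt_of_le_of_ne real_inner_self_nonneg (right_ne_zero_of_mul (h11 z hz).ne').symm
  · apply mul_left_cancel₀ (hne z hz)
    have h1 := hM z hz 1 1
    have h2 := hM z hz I I
    simp only [moebiusMetric] at h1 h2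
    rw [h2, hX.eq z hz]
    exact h1.symm
  · apply mul_left_cancel₀ (hne z hz)
    have h1 := hM z hz 1 I
    simp only [moebiusMetric] at h1
    rw [h1, hX.orth z hz, mul_zero, mul_zero]

/-- The Möbius metric is (4|Q|²/E)|dz|²: if it is fixed, E scales like |Q|². -/
theorem conformalFactor_of_moebiusMetric (hX : ConformalOn X Ω) (hY : ConformalOn Y Ω)
    (hz : z ∈ Ω) (hM : moebiusMetric Y z 1 1 = moebiusMetric X z 1 1) {c : ℂ}
    (hQ : hopfCoeff Y z = c * hopfCoeff X z) (hQ0 : hopfCoeff X z ≠ 0) :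
    conformalFactor Y z = ‖c‖ ^ 2 * conformalFactor X z := by
  have hp := (hX.pos z hz).ne'
  have hp' := (hY.pos z hz).ne'
  have hn := norm_ne_zero_iff.2 hQ0
  rw [moebiusMetric, moebiusMetric, hX.sq_sub_gauss hz, hY.sq_sub_gauss hz, hQ, norm_mul] at hM
  change _ * conformalFactor Y z = _ * conformalFactor X z at hM
  field_simp at hM
  linarith

/-- Write the principal curvatures as H ± s with s = 2|Q|/E > 0; for Y this s is divided by |c|. The
products in the ratio condition collapse to |c|H_Y = H_X, or to |c|H_Y = −H_X if the principal
curvatures are exchanged. -/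
theorem sq_meanCurvature_of_ratio (hX : ConformalOn X Ω) (hY : ConformalOn Y Ω) (hz : z ∈ Ω)
    {c : ℂ} (hc : c ≠ 0) (hE : conformalFactor Y z = ‖c‖ ^ 2 * conformalFactor X z)
    (hQ : hopfCoeff Y z = c * hopfCoeff X z) (hQ0 : hopfCoeff X z ≠ 0)
    (hR : SameCurvatureRatio X Y z) :
    (‖c‖ * meanCurvature Y z) ^ 2 = meanCurvature X z ^ 2 := by
  have hp := hX.pos z hz
  have hn := norm_pos_iff.2 hQ0
  have hcn := norm_pos_iff.2 hc
  have sX : √(meanCurvature X z ^ 2 - gaussCurvature X z)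
      = 2 * ‖hopfCoeff X z‖ / conformalFactor X z := by
    rw [hX.sq_sub_gauss hz, Real.sqrt_eq_iff_mul_self_eq (by positivity) (by positivity)]
    ring
  have sY : √(meanCurvature Y z ^ 2 - gaussCurvature Y z)
      = 2 * ‖hopfCoeff X z‖ / (‖c‖ * conformalFactor X z) := by
    rw [hY.sq_sub_gauss hz, hQ, hE, norm_mul,
      Real.sqrt_eq_iff_mul_self_eq (by positivity) (by positivity)]
    field_simp
    ring
  simp only [SameCurvatureRatio, principalCurvature₁, principalCurvature₂, sX, sY] at hR
  rcases hR with hR | hR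
  · have : ‖c‖ * meanCurvature Y z = meanCurvature X z := by
      field_simp at hR
      have h0 : (‖hopfCoeff X z‖ * conformalFactor X z) * (‖c‖ * meanCurvature Y z)
          = (‖hopfCoeff X z‖ * conformalFactor X z) * meanCurvature X z := by linarith
      exact mul_left_cancel₀ (by positivity) h0
    rw [this]
  · have : ‖c‖ * meanCurvature Y z = -meanCurvature X z := by
      field_simp at hR
      have h0 : (‖hopfCoeff X z‖ * conformalFactor X z) * (‖c‖ * meanCurvature Y z)
          = (‖hopfCoeff X z‖ * conformalFactor X z) * -meanCurvature X z := by linarith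
      exact mul_left_cancel₀ (by positivity) h0
    rw [this, neg_sq]

end ConformalOn

/-! ### Continuity in the deformation parameter -/

/-- Applied twice, it makes the second derivatives of the surfaces, hence their mean curvatures,
continuous in t. -/
theorem contDiffOn_fderiv_param {V : Type*} [NormedAddCommGroup V] [NormedSpace ℝ V] {Ω : Set ℂ}
    (ho : IsOpen Ω) {Ψ : ℝ → ℂ → V}
    (h : ContDiffOn ℝ ∞ (fun q : ℝ × ℂ => Ψ q.1 q.2) (Set.univ ×ˢ Ω)) :
    ContDiffOn ℝ ∞ (fun q : ℝ × ℂ => fderiv ℝ (Ψ q.1) q.2) (Set.univ ×ˢ Ω) := by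
  intro q hq
  have hq' : ContDiffAt ℝ ∞ (fun q : ℝ × ℂ => Ψ q.1 q.2) (q.1, q.2) :=
    h.contDiffAt ((isOpen_univ.prod ho).mem_nhds hq)
  refine (ContDiffAt.fderiv (f := fun (q : ℝ × ℂ) y => Ψ q.1 y) (g := Prod.snd) (n := ∞) ?_
    contDiffAt_snd (by simp)).contDiffWithinAt
  exact hq'.comp (f := fun p : (ℝ × ℂ) × ℂ => (p.1.1, p.2)) (q, q.2)
    ((contDiffAt_fst.comp _ contDiffAt_fst).prodMk contDiffAt_snd)

theorem continuous_slice {V : Type*} [NormedAddCommGroup V] [NormedSpace ℝ V] {Ω : Set ℂ}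
    {Ψ : ℝ → ℂ → V}
    (h : ContDiffOn ℝ ∞ (fun q : ℝ × ℂ => Ψ q.1 q.2) (Set.univ ×ˢ Ω)) {z : ℂ} (hz : z ∈ Ω) :
    Continuous fun t => Ψ t z :=
  h.continuousOn.comp_continuous (f := fun t : ℝ => (t, z)) (by fun_prop) fun _ => ⟨trivial, hz⟩

theorem Continuous.cross3 {T : Type*} [TopologicalSpace T] {a b : T → E3} (ha : Continuous a)
    (hb : Continuous b) : Continuous fun t => cross3 (a t) (b t) := by
  refine (PiLp.continuous_toLp 2 _).comp (continuous_pi fun i => ?_)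
  fin_cases i <;> simp [crossProduct] <;> fun_prop

theorem continuous_meanCurvature {Ω : Set ℂ} {Ψ : ℝ → ℂ → E3}
    (h : ContDiffOn ℝ ∞ (fun q : ℝ × ℂ => Ψ q.1 q.2) (Set.univ ×ˢ Ω))
    (hc : ∀ t, ConformalOn (Ψ t) Ω) {z : ℂ} (hz : z ∈ Ω) :
    Continuous fun t => meanCurvature (Ψ t) z := by
  have ho := (hc 0).isOpen
  have h1 := contDiffOn_fderiv_param ho h
  have h2 := contDiffOn_fderiv_param (Ψ := fun t y => fderiv ℝ (Ψ t) y) ho h1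
  have c1 : ∀ v, Continuous fun t => pd v (Ψ t) z := fun v =>
    (continuous_slice (Ψ := fun t y => fderiv ℝ (Ψ t) y) h1 hz).clm_apply continuous_const
  have c2 : ∀ v w, Continuous fun t => fderiv ℝ (fderiv ℝ (Ψ t)) z v w := fun v w =>
    ((continuous_slice (Ψ := fun t y => fderiv ℝ (fderiv ℝ (Ψ t)) y) h2 hz).clm_apply
      continuous_const).clm_apply continuous_const
  have cE : Continuous fun t => conformalFactor (Ψ t) z := (c1 1).inner (c1 1)
  have hne : ∀ t, conformalFactor (Ψ t) z ≠ 0 := fun t => ((hc t).pos z hz).ne'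
  have cN : Continuous fun t => unitNormal (Ψ t) z := by
    simp_rw [fun t => (hc t).unitNormal_eq hz]
    exact (cE.inv₀ hne).smul ((c1 1).cross3 (c1 I))
  have cS : ∀ v w, Continuous fun t => secondForm (Ψ t) z v w := fun v w => (c2 v w).inner cN
  simp_rw [fun t => (hc t).meanCurvature_eq hz]
  exact ((cS 1 1).add (cS I I)).div (continuous_const.mul cE) fun t =>
    mul_ne_zero two_ne_zero (hne t)

/-- If g 0 ≠ 0, then g never vanishes, so by the intermediate value theorem it keeps the sign of g
0, and c > 0 excludes the minus sign. No continuity of c is required. -/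
theorem eq_of_sq_eq_of_continuous {g c : ℝ → ℝ} (hg : Continuous g) (hc : ∀ t, 0 < c t)
    (h : ∀ t, (c t * g t) ^ 2 = g 0 ^ 2) (t : ℝ) : c t * g t = g 0 := by
  by_cases h0 : g 0 = 0
  · have := h t
    rw [h0] at this ⊢
    simpa using this
  have hne : ∀ s, g s * g 0 ≠ 0 := by
    intro s hs
    have hs' : g s = 0 := (mul_eq_zero.1 hs).resolve_right h0
    have := h s
    rw [hs', mul_zero, zero_pow two_ne_zero] at this
    exact pow_ne_zero 2 h0 this.symm
  have hpos : 0 < g t * g 0 := by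
    by_contra hneg
    obtain ⟨s, hs⟩ := mem_range_of_exists_le_of_exists_ge (f := fun s => g s * g 0)
      (hg.mul continuous_const) ⟨t, not_lt.1 hneg⟩ ⟨0, mul_self_nonneg (g 0)⟩
    exact hne s hs
  rcases sq_eq_sq_iff_eq_or_eq_neg.1 (h t) with h1 | h1
  · exact h1
  · exfalso
    have h2 : c t * (g t * g 0) = -(g 0 * g 0) := by rw [← mul_assoc, h1]; ring
    have h3 := mul_pos (hc t) hpos
    have h4 := mul_self_nonneg (g 0)
    linarith

/-! ### The factor λ and the scaled data of a deformation. -/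

section Manifold

variable {M : Type*} [TopologicalSpace M] [ChartedSpace ℂ M]

/-- The quotient of the Hopf differentials of two surfaces. -/
noncomputable def hopfRatio (F G : M → E3) (p : M) : ℂ :=
  hopfCoeff (G ∘ (chartAt ℂ p).symm) (chartAt ℂ p p)
    / hopfCoeff (F ∘ (chartAt ℂ p).symm) (chartAt ℂ p p)

/-- Both Hopf coefficients acquire the same factor (φ')² under a change of coordinate, so their
quotient, defined with preferred charts, serves in every coordinate. -/
theorem hopfCoeff_eq_hopfRatio_mul [IsManifold 𝓘(ℂ) ω M] {F G : M → E3}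
    (hF : ∀ e ∈ complexCoords M, ConformalOn (F ∘ e.symm) e.target)
    (hG : ∀ e ∈ complexCoords M, ConformalOn (G ∘ e.symm) e.target)
    {e : OpenPartialHomeomorph M ℂ} (he : e ∈ complexCoords M) {z : ℂ} (hz : z ∈ e.target)
    (h0 : hopfCoeff (F ∘ e.symm) z ≠ 0) :
    hopfCoeff (G ∘ e.symm) z = hopfRatio F G (e.symm z) * hopfCoeff (F ∘ e.symm) z := by
  obtain ⟨h1, h2, h3, h4⟩ := transition_spec he (chart_mem (e.symm z))
  have hs : e.target ∩ e.symm ⁻¹' (chartAt ℂ (e.symm z)).source ⊆ e.target := Set.inter_subset_left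
  have hm : z ∈ e.target ∩ e.symm ⁻¹' (chartAt ℂ (e.symm z)).source := ⟨hz, mem_chart_source ℂ _⟩
  have eF := ConformalOn.hopfCoeff_comp ((hF e he).mono h1 hs) (hF _ (chart_mem _)) h2 h3 (h4 F) hm
  have eG := ConformalOn.hopfCoeff_comp ((hG e he).mono h1 hs) (hG _ (chart_mem _)) h2 h3 (h4 G) hm
  rw [eF] at h0
  have h5 := left_ne_zero_of_mul h0
  have h6 := right_ne_zero_of_mul h0
  rw [eF, eG, hopfRatio]
  simp only [Function.comp_apply] at h6 ⊢
  field_simp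

/-- The members of a deformation that preserves the Möbius metric and the ratio of the principal
curvatures have scaled data. -/
theorem scaledData_of_deformation [IsManifold 𝓘(ℂ) ω M]
    {F : M → E3} (hF : IsConformalImmersion F) (hU : UmbilicFree F)
    {Φ : ℝ → M → E3} (hΦ : IsDeformation F Φ) (hMetric : ∀ t, SameMoebiusMetric F (Φ t))
    (hRatio : ∀ t, SamePrincipalRatio F (Φ t)) (t : ℝ) :
    ScaledData F (Φ t) (hopfRatio F (Φ t)) := by
  have hX : ∀ e ∈ complexCoords M, ConformalOn (F ∘ e.symm) e.target := fun e he =>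
    hF.conformalOn he
  have hY : ∀ t, ∀ e ∈ complexCoords M, ConformalOn (Φ t ∘ e.symm) e.target := fun t e he =>
    (hX e he).of_moebiusMetric (hU e he)
      ((hΦ.smooth e he).comp (f := fun z : ℂ => (t, z)) (contDiffOn_const.prodMk contDiffOn_id)
        fun z hz => ⟨trivial, hz⟩) (hMetric t e he)
  have hQ0 : ∀ e ∈ complexCoords M, ∀ z ∈ e.target, hopfCoeff (F ∘ e.symm) z ≠ 0 :=
    fun e he z hz => (hX e he).hopfCoeff_ne_zero hz (hU e he z hz)
  have hQ : ∀ t, ∀ e ∈ complexCoords M, ∀ z ∈ e.target, hopfCoeff (Φ t ∘ e.symm) z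
      = hopfRatio F (Φ t) (e.symm z) * hopfCoeff (F ∘ e.symm) z := fun t e he z hz =>
    hopfCoeff_eq_hopfRatio_mul hX (hY t) he hz (hQ0 e he z hz)
  have hE : ∀ t, ∀ e ∈ complexCoords M, ∀ z ∈ e.target, conformalFactor (Φ t ∘ e.symm) z
      = ‖hopfRatio F (Φ t) (e.symm z)‖ ^ 2 * conformalFactor (F ∘ e.symm) z := fun t e he z hz =>
    (hX e he).conformalFactor_of_moebiusMetric (hY t e he) hz (hMetric t e he z hz 1 1)
      (hQ t e he z hz) (hQ0 e he z hz)
  have hl : ∀ t, ∀ e ∈ complexCoords M, ∀ z ∈ e.target, hopfRatio F (Φ t) (e.symm z) ≠ 0 := by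
    intro t e he z hz h0
    have := (hY t e he).pos z hz
    rw [hE t e he z hz, h0] at this
    simp at this
  refine ⟨hX, hY t, fun p => ?_, hE t, fun e he z hz => ?_, hQ t⟩
  · have := hl t _ (chart_mem p) _ (mem_chart_target ℂ p)
    rwa [(chartAt ℂ p).left_inv (mem_chart_source ℂ p)] at this
  -- The ratio determines |λ_t|H_t only up to sign; continuity in t at a fixed point settles it.
  · have hcont := continuous_meanCurvature (Ψ := fun t => Φ t ∘ e.symm) (hΦ.smooth e he)
      (fun t => hY t e he) hz
    have hstart : meanCurvature (Φ 0 ∘ e.symm) z = meanCurvature (F ∘ e.symm) z := by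
      rw [hΦ.start]
    have := eq_of_sq_eq_of_continuous hcont (fun t => norm_pos_iff.2 (hl t e he z hz))
      (fun t => by
        rw [hstart]
        exact (hX e he).sq_meanCurvature_of_ratio (hY t e he) hz (hl t e he z hz) (hE t e he z hz)
          (hQ t e he z hz) (hQ0 e he z hz) (hRatio t e he z hz)) t
    rw [hstart] at this
    have hn := norm_ne_zero_iff.2 (hl t e he z hz)
    rw [← this]
    field_simp

end Manifold

theorem theorem2p4 {M : Type*} [TopologicalSpace M] [T2Space M] [ConnectedSpace M]
    [ChartedSpace ℂ M] [IsManifold 𝓘(ℂ) ω M]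
    (F : M → E3) (hF : IsConformalImmersion F) (hU : UmbilicFree F)
    (Φ : ℝ → M → E3) (hΦ : IsDeformation F Φ)
    (hMetric : ∀ t, SameMoebiusMetric F (Φ t))
    (hRatio : ∀ t, SamePrincipalRatio F (Φ t)) :
    ∃ l : ℝ → M → ℂ,
      (∀ t, IsConformalImmersion (Φ t)) ∧
      (∀ t, ∀ e ∈ complexCoords M, ∀ z ∈ e.target,
        conformalFactor (Φ t ∘ e.symm) z
            = ‖l t (e.symm z)‖ ^ 2 * conformalFactor (F ∘ e.symm) z ∧
        meanCurvature (Φ t ∘ e.symm) z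
            = 1 / ‖l t (e.symm z)‖ * meanCurvature (F ∘ e.symm) z ∧
        hopfCoeff (Φ t ∘ e.symm) z = l t (e.symm z) * hopfCoeff (F ∘ e.symm) z) ∧
      (∀ t, ∀ U : Set M, IsOpen U → SimplyConnectedSpace U →
        ∃ f : M → ℂ, MDifferentiableOn 𝓘(ℂ) 𝓘(ℂ) f U ∧ ∀ p ∈ U, ‖l t p‖ = ‖f p‖) ∧
      ((∃ t, ¬ SimilarSurfaces F (Φ t)) → (∀ t p, ‖l t p‖ = 1) → IsBonnetSurface F) ∧
      (¬ IsMinimalSurface F →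
        (∃ t, ¬ SimilarSurfaces F (Φ t) ∧ MDifferentiable 𝓘(ℂ) 𝓘(ℂ) (l t)) → IsHIMCSurface F) := by
  have h := scaledData_of_deformation hF hU hΦ hMetric hRatio
  refine ⟨fun t => hopfRatio F (Φ t), fun t => ⟨fun e he => ((h t).right e he).smooth,
    fun e he z hz => ((h t).right e he).conformalAt hz⟩,
    fun t e he z hz => ⟨(h t).factor e he z hz, (h t).mean e he z hz, (h t).hopf e he z hz⟩,
    fun t U hUo hs => (h t).exists_holomorphic_norm_eq hUo hs, ?_, ?_⟩
  · rintro ⟨t₀, ht₀⟩ hl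
    -- With |λ_t| = 1 the deformation is isometric and preserves H. It is nontrivial because a
    -- congruence is a similarity with r = 1.
    refine ⟨Φ, hΦ, fun t e he z hz => ⟨fun v w => ?_, ?_⟩, t₀, fun ⟨A, b, hA⟩ => ht₀ ?_⟩
    · rw [((h t).right e he).inner_fderiv hz, ((h t).left e he).inner_fderiv hz,
        (h t).factor e he z hz, hl]
      simp
    · rw [(h t).mean e he z hz, hl]
      simp
    · exact ⟨1, A, b, one_pos, fun p => by rw [hA p, one_smul]⟩
  · rintro hmin ⟨t, hsim, hhol⟩
    exact (h t).isHIMCSurface hhol hmin hsim
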